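/- Consider one cell of a Massive MIMO system whose base station (BS) has $M$ antennas. Finitely many UEs $i$ with channel gains $\beta_i>0$ and powers $\rho_i\ge 0$ select uplink pilots $\boldsymbol\psi_{c(i)}$ among mutually orthogonal $\boldsymbol\psi_1,\dots,\boldsymbol\psi_{\tau_p}\in\mathbb C^{\tau_p}$ with $\|\boldsymbol\psi_t\|^2=\tau_p$. The BS receives $$\mathbf Y=\sum_i\sqrt{\rho_i}\,\mathbf h_i\boldsymbol\psi_{c(i)}^{T}+\mathbf W+\mathbf N,\qquad \mathbf W=\sum_l\mathbf w_l\mathbf d_l^{T}+\sum_j\sqrt{\rho'_j}\,\mathbf g_j\boldsymbol\psi_{c'(j)}^{T},$$ where the finitely many interferers in other cells have gains $\beta_{w,l},\beta'_j\ge0$, powers $\rho'_j\ge0$, data sequences $\mathbf d_l$ and pilot indices $c'(j)$. It forms $\mathbf y_t=\mathbf Y\boldsymbol\psi_t^*/\|\boldsymbol\psi_t\|$ and transmits $\mathbf V=\sqrt q\sum_t\frac{\mathbf y_t^*}{\|\mathbf y_t\|}\boldsymbol\phi_t^{T}$, with power $q>0$ and mutually orthogonal $\boldsymbol\phi_t\in\mathbb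 C^{\tau_p}$, $\|\boldsymbol\phi_t\|^2=\tau_p$. Fix a pilot $t$ and a UE $k\in\mathcal S_t=\{i:c(i)=t,\rho_i>0\}$; it computes $$z_k=\bigl(\mathbf h_k^{T}\mathbf V+\boldsymbol\upsilon_k^{T}+\boldsymbol\eta_k^{T}\bigr)\frac{\boldsymbol\phi_t^*}{\|\boldsymbol\phi_t\|}.$$ Fading is uncorrelated Rayleigh: $\mathbf h_i\sim\mathcal{CN}(\mathbf 0,\beta_i\mathbf I_M)$, $\mathbf w_l\sim\mathcal{CN}(\mathbf 0,\beta_{w,l}\mathbf I_M)$, $\mathbf g_j\sim\mathcal{CN}(\mathbf 0,\beta'_j\mathbf I_M)$, $\mathbf N$ has i.i.d. $\mathcal{CN}(0,\sigma^2)$ entries, $\boldsymbol\upsilon_k\sim\mathcal{CN}(\mathbf 0,\Upsilon_k\mathbf I_{\tau_p})$, $\boldsymbol\eta_k\sim\mathcal{CN}(\mathbf 0,\sigma^2\mathbf I_{\tau_p})$, all independent, with $\sigma^2>0$ and $\Upsilon_k\ge0$. All other quantities are deterministic and do not depend on $M$. Let $$\alpha_t=\sum_{i\in\mathcal S_t}\rho_i\beta_i\tau_p+\sum_l\beta_{w,l}\frac{|\mathbf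 d_l^{T}\boldsymbol\psi_t^*|^2}{\|\boldsymbol\psi_t\|^2}+\sum_{j:\,c'(j)=t}\rho'_j\tau_p\beta'_j,$$ $$\lambda_1=\frac{\rho_kq\beta_k^2\tau_p^2}{\alpha_t+\sigma^2},\qquad \lambda_2=\sigma^2+\Upsilon_k+q\beta_k\tau_p-\lambda_1,\qquad C_M=\frac{\Gamma(M+\frac12)}{\Gamma(M)},\qquad Q(x)=\frac1{\sqrt{2\pi}}\int_x^\infty e^{-s^2/2}\,ds.$$ (a) As $M\to\infty$, $$\sup_{b\in\mathbb R}\left|\Pr\{\Re(z_k)>b\}-Q\!\left(\frac{b-C_M\sqrt{\lambda_1}}{\sqrt{\lambda_1(M-C_M^2)+\lambda_2/2}}\right)\right|\to0 .$$ For each fixed $b\in\mathbb R$ the difference also tends to $0$ when the expression under the root in the denominator is replaced by $\lambda_1^2(M-C_M^2)+\lambda_2$. (b) Let $\epsilon_k\in\mathbb R$ with $\epsilon_k<\rho_k\beta_k\tau_p/2$, and let UE $k$ repeat the pilot (event $\mathcal R_k$) if and only if $\rho_k\beta_k\tau_p>\hat\alpha_{t,k}/2+\epsilon_k$, where $$\hat\alpha_{t,k}=\max\!\left(C_M^2\,\frac{q\rho_k\beta_k^2\tau_p^2}{(\Re(z_k))^2}-\sigma^2,\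 \rho_k\beta_k\tau_p\right).$$ Then $$\lim_{M\to\infty}\Pr\{\mathcal R_k\}=\begin{cases}0,&\rho_k\beta_k\tau_p<\alpha_t/2+\epsilon_k,\\ 1/2,&\rho_k\beta_k\tau_p=\alpha_t/2+\epsilon_k,\\ 1,&\rho_k\beta_k\tau_p>\alpha_t/2+\epsilon_k.\end{cases}$$ -/

import Mathlib

open MeasureTheory ProbabilityTheory Filter Topology
open scoped NNReal ComplexConjugate

noncomputable section

namespace SUCRe

/-- The circularly symmetric complex Gaussian law `CN(0, v)`: the real and imaginary parts are
independent real Gaussian variables with mean `0` and variance `v / 2`. -/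
def complexGaussian (v : ℝ) : Measure ℂ :=
  ((gaussianReal 0 (v / 2).toNNReal).prod (gaussianReal 0 (v / 2).toNNReal)).map
    (fun p : ℝ × ℝ => (⟨p.1, p.2⟩ : ℂ))

/-- The `Q`-function `Q(x) = (2π)^(-1/2) ∫_x^∞ exp(-t²/2) dt`. -/
def Q (x : ℝ) : ℝ :=
  1 / Real.sqrt (2 * Real.pi) * ∫ t in Set.Ioi x, Real.exp (-t ^ 2 / 2)

/-- The Euclidean norm of a complex vector. -/
def vnorm {n : ℕ} (v : Fin n → ℂ) : ℝ := ‖WithLp.toLp 2 v‖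

/-- The ratio `Γ(M + 1/2) / Γ(M)`. -/
def gammaRatio (M : ℕ) : ℝ := Real.Gamma ((M : ℝ) + 1 / 2) / Real.Gamma (M : ℝ)

/-- The deterministic parameters of a random access block with `τ` pilots: `K` is the set of
inactive UEs of the cell, `L` the set of interferers that send data, and `J` the set of
interferers in other cells that send random access pilots. None of them depends on the number
of antennas. -/
structure Cell (K L J : Type*) (τ : ℕ) where
  /-- channel gains of the UEs -/
  β : K → ℝ
  β_pos : ∀ k, 0 < β k
  /-- transmit powers of the UEs, zero for a UE that stays silent -/
  ρ : K → ℝ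
  ρ_nonneg : ∀ k, 0 ≤ ρ k
  /-- the pilot selected by each UE -/
  c : K → Fin τ
  /-- uplink pilots: mutually orthogonal with squared norm `τ` -/
  ψ : Fin τ → Fin τ → ℂ
  ψ_orth : ∀ s t, ∑ j, ψ s j * conj (ψ t j) = if s = t then (τ : ℂ) else 0
  /-- downlink pilots: mutually orthogonal with squared norm `τ` -/
  φ : Fin τ → Fin τ → ℂ
  φ_orth : ∀ s t, ∑ j, φ s j * conj (φ t j) = if s = t then (τ : ℂ) else 0
  /-- channel gains of the data interferers -/
  βd : L → ℝ
  βd_nonneg : ∀ l, 0 ≤ βd l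
  /-- data sequences sent by the data interferers -/
  d : L → Fin τ → ℂ
  /-- channel gains of the pilot interferers -/
  βi : J → ℝ
  βi_nonneg : ∀ j, 0 ≤ βi j
  /-- transmit powers of the pilot interferers -/
  ρi : J → ℝ
  ρi_nonneg : ∀ j, 0 ≤ ρi j
  /-- the pilot used by each pilot interferer -/
  ci : J → Fin τ
  /-- variance of the downlink inter-cell interference at each UE -/
  Υ : K → ℝ
  Υ_nonneg : ∀ k, 0 ≤ Υ k
  /-- noise variance -/
  σ2 : ℝ
  σ2_pos : 0 < σ2
  /-- downlink transmit power -/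
  q : ℝ
  q_pos : 0 < q

/-- Indices of the scalar random variables in the model with `M` antennas, as seen by one UE. -/
inductive Source (K L J : Type*) (τ M : ℕ)
  /-- the channel coefficient `[h_i]_m` of UE `i` -/
  | channel (i : K) (m : Fin M)
  /-- the channel coefficient `[w_l]_m` of a data interferer -/
  | dataChannel (l : L) (m : Fin M)
  /-- the channel coefficient `[g_j]_m` of a pilot interferer -/
  | pilotChannel (j : J) (m : Fin M)
  /-- the uplink receiver noise `[N]_{m,s}` -/
  | ulNoise (m : Fin M) (s : Fin τ)
  /-- the downlink inter-cell interference `[υ_k]_s` at the UE -/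
  | dlInterference (s : Fin τ)
  /-- the downlink receiver noise `[η_k]_s` at the UE -/
  | dlNoise (s : Fin τ)

namespace Cell

variable {K L J : Type*} {τ : ℕ}

section Parameters

open Classical in
/-- The set `S_t` of UEs that transmit pilot `t`. -/
def contenders [Fintype K] (S : Cell K L J τ) (t : Fin τ) : Finset K :=
  Finset.univ.filter (fun i => S.c i = t ∧ 0 < S.ρ i)

/-- The uplink interference gain
`ω_t = ∑_l β_{w,l} |d_lᵀ ψ_t^*|² / ‖ψ_t‖² + ∑_{j uses pilot t} ρ_j τ β_j`. -/
def ω [Fintype L] [Fintype J] (S : Cell K L J τ) (t : Fin τ) : ℝ :=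
  (∑ l, S.βd l * (‖∑ s, S.d l s * conj (S.ψ t s)‖ ^ 2 / vnorm (S.ψ t) ^ 2))
    + ∑ j with S.ci j = t, S.ρi j * τ * S.βi j

/-- The sum of the signal and interference gains `α_t = ∑_{i ∈ S_t} ρ_i β_i τ + ω_t`. -/
def α [Fintype K] [Fintype L] [Fintype J] (S : Cell K L J τ) (t : Fin τ) : ℝ :=
  (∑ i ∈ S.contenders t, S.ρ i * S.β i * τ) + S.ω t

/-- `λ₁ = ρ_k q β_k² τ² / (α_t + σ²)`. -/
def lam1 [Fintype K] [Fintype L] [Fintype J] (S : Cell K L J τ) (t : Fin τ) (k : K) : ℝ :=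
  S.ρ k * S.q * S.β k ^ 2 * (τ : ℝ) ^ 2 / (S.α t + S.σ2)

/-- `λ₂ = σ² + Υ_k + q β_k τ - λ₁`. -/
def lam2 [Fintype K] [Fintype L] [Fintype J] (S : Cell K L J τ) (t : Fin τ) (k : K) : ℝ :=
  S.σ2 + S.Υ k + S.q * S.β k * τ - S.lam1 t k

end Parameters

section Signals

variable {M : ℕ}

/-- The inter-cell interference matrix
`W = ∑_l w_l d_lᵀ + ∑_j √ρ_j g_j ψ_{c(j)}ᵀ` for a realization `x` of the sources. -/
def W [Fintype L] [Fintype J] (S : Cell K L J τ) (x : Source K L J τ M → ℂ) :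
    Matrix (Fin M) (Fin τ) ℂ := fun m s =>
  (∑ l, x (.dataChannel l m) * S.d l s)
    + ∑ j, (Real.sqrt (S.ρi j) : ℂ) * x (.pilotChannel j m) * S.ψ (S.ci j) s

/-- The received uplink signal `Y = ∑_i √ρ_i h_i ψ_{c(i)}ᵀ + W + N`. -/
def Y [Fintype K] [Fintype L] [Fintype J] (S : Cell K L J τ) (x : Source K L J τ M → ℂ) :
    Matrix (Fin M) (Fin τ) ℂ := fun m s =>
  (∑ i, (Real.sqrt (S.ρ i) : ℂ) * x (.channel i m) * S.ψ (S.c i) s)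
    + S.W x m s + x (.ulNoise m s)

/-- The correlated uplink signal `y_t = Y ψ_t^* / ‖ψ_t‖`. -/
def y [Fintype K] [Fintype L] [Fintype J] (S : Cell K L J τ) (x : Source K L J τ M → ℂ)
    (t : Fin τ) : Fin M → ℂ := fun m =>
  ∑ s, S.Y x m s * (conj (S.ψ t s) / (vnorm (S.ψ t) : ℂ))

/-- The precoded downlink pilot signal `V = √q ∑_t (y_t^* / ‖y_t‖) φ_tᵀ`. -/
def V [Fintype K] [Fintype L] [Fintype J] (S : Cell K L J τ) (x : Source K L J τ M → ℂ) :
    Matrix (Fin M) (Fin τ) ℂ := fun m s =>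
  (Real.sqrt S.q : ℂ) * ∑ t, conj (S.y x t m) / (vnorm (S.y x t) : ℂ) * S.φ t s

/-- The signal received by UE `k`: `z_kᵀ = h_kᵀ V + υ_kᵀ + η_kᵀ`. -/
def zvec [Fintype K] [Fintype L] [Fintype J] (S : Cell K L J τ) (x : Source K L J τ M → ℂ)
    (k : K) : Fin τ → ℂ := fun s =>
  (∑ m, x (.channel k m) * S.V x m s) + x (.dlInterference s) + x (.dlNoise s)

/-- The correlated received signal `z_k = z_kᵀ φ_t^* / ‖φ_t‖` of UE `k`. -/
def z [Fintype K] [Fintype L] [Fintype J] (S : Cell K L J τ) (x : Source K L J τ M → ℂ)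
    (t : Fin τ) (k : K) : ℂ :=
  ∑ s, S.zvec x k s * (conj (S.φ t s) / (vnorm (S.φ t) : ℂ))

/-- The estimate of `α_t` that UE `k` computes from `Re z_k`. -/
def αhat [Fintype K] [Fintype L] [Fintype J] (S : Cell K L J τ) (x : Source K L J τ M → ℂ)
    (t : Fin τ) (k : K) : ℝ :=
  max (gammaRatio M ^ 2 * (S.q * S.ρ k * S.β k ^ 2 * (τ : ℝ) ^ 2 / (S.z x t k).re ^ 2) - S.σ2)
    (S.ρ k * S.β k * τ)

/-- The decision rule: UE `k` with bias `ε` repeats the pilot. -/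
def Repeats [Fintype K] [Fintype L] [Fintype J] (S : Cell K L J τ) (x : Source K L J τ M → ℂ)
    (t : Fin τ) (k : K) (ε : ℝ) : Prop :=
  S.ρ k * S.β k * τ > S.αhat x t k / 2 + ε

/-- The variance of each source, as seen by UE `k`. -/
def sourceVar (S : Cell K L J τ) (k : K) : Source K L J τ M → ℝ
  | .channel i _ => S.β i
  | .dataChannel l _ => S.βd l
  | .pilotChannel j _ => S.βi j
  | .ulNoise _ _ => S.σ2
  | .dlInterference _ => S.Υ k
  | .dlNoise _ => S.σ2

/-- Uncorrelated Rayleigh fading: all sources are independent, circularly symmetric complex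
Gaussian variables; that is, the channels are `CN(0, β I_M)`, the interference at UE `k` is
`CN(0, Υ_k I_τ)`, the noise is white with variance `σ²`, and all of these are independent. -/
structure IsRayleigh (S : Cell K L J τ) (k : K) {Ω : Type*} [MeasurableSpace Ω] (P : Measure Ω)
    (X : Source K L J τ M → Ω → ℂ) : Prop where
  hasLaw : ∀ s, HasLaw (X s) (complexGaussian (S.sourceVar k s)) P
  indep : iIndepFun X P

end Signals

end Cell

end SUCRe

end

/-! Regress `h_k` on `y_t`. All variables are jointly Gaussian, so the residual of `h_k` is
independent of `y_t`, and `Re z_k` splits into `√λ₁ ‖y_t‖ / √(α_t + σ²)` plus the real part of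
residual and downlink noise projected on fixed-norm directions. Given `y_t`, that second part is a
centred Gaussian of variance `λ₂ / 2`. This variance does not depend on `y_t`, so the second part is
independent of the first (`re_z_eq`, `charFun_re_z`).

The entries of `y_t` are i.i.d. `CN(0, α_t + σ²)`. The central limit theorem for `‖y_t‖²`, followed
by linearization of the square root, shows that `‖y_t‖ / √(α_t + σ²) - √M` tends to `N(0, 1/4)`
(`tendsto_charFun_vnorm`). Log-convexity and the recursion of `Γ` give `M - C_M² → 1/4`, hence `√M -
C_M → 0`. So `C_M √λ₁` is a valid centring, and the variance in the `Q`-function has the right limit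
`λ₁ / 4 + λ₂ / 2`. Pólya's theorem makes the convergence uniform.

For fixed `b` the centre escapes to infinity while the scale stays bounded, so every term tends to
`1`, whichever positive limiting variance is used. For the decision rule, repeating means `Re z_k`
exceeds a multiple of `C_M`, up to the event `Re z_k ≤ 0` of vanishing probability. Uniformity
permits this moving threshold, and the sign of its distance to `√λ₁ C_M` decides between `0`, `1/2`
and `1`. -/

namespace SUCRe

/-! ### The ratio `Γ(M + 1/2) / Γ(M)` -/

lemma gammaRatio_pos {M : ℕ} (hM : 0 < M) : 0 < gammaRatio M := by
  have : (0 : ℝ) < M := by exact_mod_cast hM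
  exact div_pos (Real.Gamma_pos_of_pos (by positivity)) (Real.Gamma_pos_of_pos this)

lemma gammaRatio_succ {M : ℕ} (hM : 0 < M) :
    gammaRatio (M + 1) = gammaRatio M * ((M + 1 / 2) / M) := by
  have h : (0 : ℝ) < M := by exact_mod_cast hM
  have hG := (Real.Gamma_pos_of_pos h).ne'
  have h1 : Real.Gamma (((M + 1 : ℕ) : ℝ) + 1 / 2) = (M + 1 / 2) * Real.Gamma (M + 1 / 2) := by
    rw [← Real.Gamma_add_one (by positivity)]; congr 1; push_cast; ring
  have h2 : Real.Gamma ((M + 1 : ℕ) : ℝ) = M * Real.Gamma M := by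
    rw [← Real.Gamma_add_one h.ne']; push_cast; rfl
  rw [gammaRatio, gammaRatio, h1, h2]
  field_simp

/-- Log-convexity of `Γ`, with both weights `1 / 2`. The midpoints `M + 1/2` and `M` then give the
crude bounds `M - 1/2 ≤ C_M² ≤ M`. -/
lemma Gamma_midpoint_sq_le {s t : ℝ} (hs : 0 < s) (ht : 0 < t) :
    Real.Gamma ((s + t) / 2) ^ 2 ≤ Real.Gamma s * Real.Gamma t := by
  have h := Real.Gamma_mul_add_mul_le_rpow_Gamma_mul_rpow_Gamma hs ht
    (a := 1 / 2) (b := 1 / 2) (by norm_num) (by norm_num) (by norm_num)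
  rw [← Real.sqrt_eq_rpow, ← Real.sqrt_eq_rpow] at h
  have hs' := (Real.Gamma_pos_of_pos hs).le
  have ht' := (Real.Gamma_pos_of_pos ht).le
  have h0 := (Real.Gamma_pos_of_pos (show 0 < (s + t) / 2 by positivity)).le
  rw [show 1 / 2 * s + 1 / 2 * t = (s + t) / 2 by ring] at h
  calc _ ≤ (√(Real.Gamma s) * √(Real.Gamma t)) ^ 2 := by gcongr
    _ = _ := by rw [mul_pow, Real.sq_sqrt hs', Real.sq_sqrt ht']

lemma gammaRatio_sq_le {M : ℕ} (hM : 0 < M) : gammaRatio M ^ 2 ≤ M := by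
  have h : (0 : ℝ) < M := by exact_mod_cast hM
  have hG := Real.Gamma_pos_of_pos h
  have := Gamma_midpoint_sq_le h (show (0 : ℝ) < M + 1 by positivity)
  rw [Real.Gamma_add_one h.ne', show ((M : ℝ) + (M + 1)) / 2 = M + 1 / 2 by ring] at this
  rw [gammaRatio, div_pow, div_le_iff₀ (by positivity)]
  linarith

lemma le_gammaRatio_sq {M : ℕ} (hM : 0 < M) : (M : ℝ) - 1 / 2 ≤ gammaRatio M ^ 2 := by
  have h : (1 : ℝ) ≤ M := by exact_mod_cast hM
  have hM' : (0 : ℝ) < M - 1 / 2 := by linarith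
  have hG := Real.Gamma_pos_of_pos (show (0 : ℝ) < M by linarith)
  have := Gamma_midpoint_sq_le hM' (show (0 : ℝ) < M + 1 / 2 by linarith)
  have h2 : Real.Gamma ((M : ℝ) + 1 / 2) = (M - 1 / 2) * Real.Gamma (M - 1 / 2) := by
    rw [← Real.Gamma_add_one hM'.ne']; congr 1; ring
  rw [show ((M : ℝ) - 1 / 2 + (M + 1 / 2)) / 2 = M by ring] at this
  rw [gammaRatio, div_pow, le_div_iff₀ (by positivity)]
  calc _ ≤ (M - 1 / 2) * (Real.Gamma (M - 1 / 2) * Real.Gamma (M + 1 / 2)) := by gcongr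
    _ = _ := by rw [← mul_assoc, ← h2, sq]

/-- The crude bounds fix the ratio to first order. With monotonicity in `n`, the limit `1` becomes a
one-sided bound for every `n`; the correction `e` selects which one. -/
lemma tendsto_gammaRatio_sq_div (e : ℕ → ℝ) (he : ∀ n, |e n| ≤ 1 / 4) :
    Tendsto (fun n : ℕ ↦ gammaRatio (n + 1) ^ 2 / ((n : ℝ) + 1 + e n)) atTop (𝓝 1) := by
  have h : Tendsto (fun n : ℕ ↦ (3 / 4 : ℝ) / ((n : ℝ) + 3 / 4)) atTop (𝓝 0) :=
    tendsto_const_nhds.div_atTop (tendsto_atTop_add_const_right _ _ tendsto_natCast_atTop_atTop)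
  rw [tendsto_iff_norm_sub_tendsto_zero]
  refine squeeze_zero (fun _ ↦ norm_nonneg _) (fun n ↦ ?_) h
  have h1 := gammaRatio_sq_le n.succ_pos
  have h2 := le_gammaRatio_sq n.succ_pos
  have h3 := abs_le.1 (he n)
  push_cast at h1 h2
  have hn : (0 : ℝ) ≤ n := n.cast_nonneg
  have hp : (0 : ℝ) < n + 1 + e n := by linarith
  rw [div_sub_one hp.ne', norm_div, Real.norm_of_nonneg hp.le, Real.norm_eq_abs]
  exact div_le_div₀ (by norm_num) (by rw [abs_le]; constructor <;> linarith) (by linarith)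
    (by linarith)

/-- `C_M² / (M - 1/4)` decreases to `1`: by the recursion this is `(M + 1/2)² (M - 1/4) ≤ M² (M +
3/4)`, whose sides differ by `1/16`. Here `M = n + 1`. -/
lemma sub_quarter_le_gammaRatio_sq (n : ℕ) : (n : ℝ) + 3 / 4 ≤ gammaRatio (n + 1) ^ 2 := by
  have hanti : Antitone (fun n : ℕ ↦ gammaRatio (n + 1) ^ 2 / ((n : ℝ) + 1 + (-1 / 4))) := by
    refine antitone_nat_of_succ_le fun n ↦ ?_
    have hn : (0 : ℝ) ≤ n := n.cast_nonneg
    have h : (0 : ℝ) < gammaRatio (n + 1) ^ 2 := pow_pos (gammaRatio_pos n.succ_pos) 2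
    rw [gammaRatio_succ n.succ_pos, mul_pow, div_le_div_iff₀ (by push_cast; linarith) (by linarith),
      mul_assoc]
    gcongr
    push_cast
    rw [div_pow, div_mul_eq_mul_div, div_le_iff₀ (by positivity)]
    nlinarith
  have := hanti.le_of_tendsto
    (tendsto_gammaRatio_sq_div (fun _ ↦ -1 / 4) (fun _ ↦ by norm_num [abs_le])) n
  have hn : (0 : ℝ) ≤ n := n.cast_nonneg
  rw [le_div_iff₀ (by linarith)] at this
  linarith

lemma gammaRatio_sq_le_add (n : ℕ) :
    gammaRatio (n + 1) ^ 2 ≤ (n : ℝ) + 1 + (-1 / 4 + 1 / 16 / (n + 1)) := by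
  have hpos : ∀ n : ℕ, (0 : ℝ) < (n : ℝ) + 1 + (-1 / 4 + 1 / 16 / (n + 1)) := fun n ↦ by
    have : (0 : ℝ) < 1 / 16 / (n + 1) := by positivity
    have hn : (0 : ℝ) ≤ n := n.cast_nonneg
    linarith
  have hmono : Monotone
      (fun n : ℕ ↦ gammaRatio (n + 1) ^ 2 / ((n : ℝ) + 1 + (-1 / 4 + 1 / 16 / (n + 1)))) := by
    refine monotone_nat_of_le_succ fun n ↦ ?_
    have hn : (0 : ℝ) ≤ n := n.cast_nonneg
    have h : (0 : ℝ) < gammaRatio (n + 1) ^ 2 := pow_pos (gammaRatio_pos n.succ_pos) 2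
    rw [gammaRatio_succ n.succ_pos, mul_pow, div_le_div_iff₀ (hpos n) (hpos (n + 1)),
      mul_assoc]
    gcongr
    push_cast
    rw [div_pow, div_mul_eq_mul_div, le_div_iff₀ (by positivity), ← sub_nonneg]
    -- The correction `1 / (16 M)` outweighs the deficit `1/16` left by `M - 1/4` alone, so the
    -- ratio now increases to `1`.
    have : ((n : ℝ) + 1 + 1 / 2) ^ 2 * (n + 1 + (-1 / 4 + 1 / 16 / (n + 1)))
        - (n + 1 + 1 + (-1 / 4 + 1 / 16 / (n + 1 + 1))) * (n + 1) ^ 2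
        = 1 / 64 / (n + 1) + (n + 1) / (16 * (n + 2)) := by
      field_simp; ring
    rw [this]; positivity
  have := hmono.ge_of_tendsto (tendsto_gammaRatio_sq_div (fun n ↦ -1 / 4 + 1 / 16 / ((n : ℝ) + 1))
    (fun n ↦ by
      have hn : (0 : ℝ) ≤ n := n.cast_nonneg
      have h1 : (0 : ℝ) < 1 / 16 / (n + 1) := by positivity
      have h2 : (1 / 16 / (n + 1) : ℝ) ≤ 1 / 16 := div_le_self (by norm_num) (by linarith)
      rw [abs_le]; constructor <;> linarith)) n
  rwa [div_le_one (hpos n)] at this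

lemma tendsto_sub_gammaRatio_sq :
    Tendsto (fun M : ℕ ↦ (M : ℝ) - gammaRatio M ^ 2) atTop (𝓝 (1 / 4)) := by
  rw [← tendsto_add_atTop_iff_nat 1]
  have h : Tendsto (fun n : ℕ ↦ (1 / 4 : ℝ) - 1 / 16 / ((n : ℝ) + 1)) atTop (𝓝 (1 / 4 - 0)) :=
    tendsto_const_nhds.sub (tendsto_const_nhds.div_atTop
      (tendsto_atTop_add_const_right _ _ tendsto_natCast_atTop_atTop))
  rw [sub_zero] at h
  refine tendsto_of_tendsto_of_tendsto_of_le_of_le h tendsto_const_nhds (fun n ↦ ?_) (fun n ↦ ?_)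
  · have := gammaRatio_sq_le_add n
    push_cast; linarith
  · have := sub_quarter_le_gammaRatio_sq n
    push_cast; linarith

lemma tendsto_gammaRatio_atTop : Tendsto gammaRatio atTop atTop := by
  have h : Tendsto (fun M : ℕ ↦ √((M : ℝ) - 1 / 2)) atTop atTop :=
    Real.tendsto_sqrt_atTop.comp
      (tendsto_atTop_add_const_right _ _ tendsto_natCast_atTop_atTop)
  refine tendsto_atTop_mono' _ ?_ h
  filter_upwards [eventually_gt_atTop 0] with M hM
  exact Real.sqrt_le_iff.2 ⟨(gammaRatio_pos hM).le, le_gammaRatio_sq hM⟩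

lemma tendsto_sqrt_sub_gammaRatio :
    Tendsto (fun M : ℕ ↦ √(M : ℝ) - gammaRatio M) atTop (𝓝 0) := by
  have h : Tendsto (fun M : ℕ ↦ ((M : ℝ) - gammaRatio M ^ 2) / (√M + gammaRatio M)) atTop (𝓝 0) :=
    tendsto_sub_gammaRatio_sq.div_atTop (tendsto_atTop_mono (fun M ↦ le_add_of_nonneg_left (Real.sqrt_nonneg _)) tendsto_gammaRatio_atTop)
  refine h.congr' ?_
  filter_upwards [eventually_gt_atTop 0] with M hM
  have := gammaRatio_pos hM
  rw [div_eq_iff (by positivity)]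
  linear_combination - Real.sq_sqrt (show (0 : ℝ) ≤ M by positivity)

/-! ### The `Q`-function -/

lemma Q_eq_gaussianReal (x : ℝ) : Q x = (gaussianReal 0 1).real (Set.Ioi x) := by
  rw [Measure.real, gaussianReal_apply_eq_integral _ one_ne_zero, ENNReal.toReal_ofReal
    (integral_nonneg fun _ ↦ gaussianPDFReal_nonneg _ _ _), Q, ← integral_const_mul]
  simp [gaussianPDFReal_def]

lemma Q_eq_one_sub_cdf (x : ℝ) : Q x = 1 - cdf (gaussianReal 0 1) x := by
  rw [Q_eq_gaussianReal, cdf_eq_real, ← Set.compl_Iic, probReal_compl_eq_one_sub measurableSet_Iic]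

lemma antitone_Q : Antitone Q := fun x y h ↦ by
  rw [Q_eq_gaussianReal, Q_eq_gaussianReal]
  exact measureReal_mono (Set.Ioi_subset_Ioi h)

lemma Q_nonneg (x : ℝ) : 0 ≤ Q x := by
  rw [Q_eq_gaussianReal]; exact measureReal_nonneg

lemma Q_le_one (x : ℝ) : Q x ≤ 1 := by
  rw [Q_eq_gaussianReal]; exact measureReal_le_one

lemma tendsto_Q_atTop : Tendsto Q atTop (𝓝 0) := by
  simp_rw [funext Q_eq_one_sub_cdf]
  simpa using (tendsto_cdf_atTop (gaussianReal 0 1)).const_sub 1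

lemma tendsto_Q_atBot : Tendsto Q atBot (𝓝 1) := by
  simp_rw [funext Q_eq_one_sub_cdf]
  simpa using (tendsto_cdf_atBot (gaussianReal 0 1)).const_sub 1

lemma Q_zero : Q 0 = 1 / 2 := by
  have h := integral_gaussian_Ioi (1 / 2)
  rw [Q, show (fun t : ℝ ↦ Real.exp (-t ^ 2 / 2)) = fun t ↦ Real.exp (-(1 / 2) * t ^ 2) by
    ext t; ring_nf, h, show Real.pi / (1 / 2) = 2 * Real.pi by ring]
  have : 0 < √(2 * Real.pi) := Real.sqrt_pos.2 (by positivity)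
  field_simp

lemma continuous_Q : Continuous Q := by
  have hint : Integrable (fun t : ℝ ↦ Real.exp (-t ^ 2 / 2)) := by
    convert! integrable_exp_neg_mul_sq (b := 1 / 2) (by norm_num) using 3
    ring
  have : ∀ x, Q x = 1 / √(2 * Real.pi) * ((∫ t in Set.Ioi 0, Real.exp (-t ^ 2 / 2))
      - ∫ t in (0 : ℝ)..x, Real.exp (-t ^ 2 / 2)) := fun x ↦ by
    rw [Q, ← intervalIntegral.integral_Ioi_sub_Ioi' hint.integrableOn hint.integrableOn]
    ring_nf
  rw [funext this]
  exact continuous_const.mul (continuous_const.sub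
    (intervalIntegral.continuous_primitive (fun _ _ ↦ hint.intervalIntegrable) 0))

lemma gaussianReal_real_Ioi {v : ℝ≥0} (hv : 0 < v) (x : ℝ) :
    (gaussianReal 0 v).real (Set.Ioi x) = Q (x / √v) := by
  have hs : (0 : ℝ) < √v := Real.sqrt_pos.2 hv
  have h := gaussianReal_map_const_mul (μ := 0) (v := 1) (√v)
  have h2 : NNReal.mk (√v ^ 2) (sq_nonneg _) * 1 = v := by
    ext; simp
  rw [mul_zero, h2] at h
  rw [← h, map_measureReal_apply (by fun_prop) measurableSet_Ioi, Q_eq_gaussianReal]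
  congr 1
  ext y
  simp [div_lt_iff₀ hs, mul_comm]

/-! ### Uniform convergence of tail functions -/

/-- Pólya's theorem: pointwise convergence of antitone functions to a continuous tail function
is uniform. -/
lemma tendstoUniformly_of_antitone {F : ℕ → ℝ → ℝ} {G : ℝ → ℝ}
    (hF : ∀ n, Antitone (F n)) (hF0 : ∀ n x, 0 ≤ F n x) (hF1 : ∀ n x, F n x ≤ 1)
    (hG : Continuous G) (hGanti : Antitone G) (hGbot : Tendsto G atBot (𝓝 1))
    (hGtop : Tendsto G atTop (𝓝 0))
    (h : ∀ x, Tendsto (fun n ↦ F n x) atTop (𝓝 (G x))) :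
    TendstoUniformly F G atTop := by
  have hloc : TendstoLocallyUniformly F G atTop := by
    rw [Metric.tendstoLocallyUniformly_iff]
    intro ε hε x
    have hc := Metric.continuousAt_iff.1 (hG.continuousAt (x := x)) (ε / 4) (by positivity)
    obtain ⟨δ, hδ, hc⟩ := hc
    have ha := abs_lt.1 (hc (x := x - δ / 2) (by
      rw [Real.dist_eq, abs_lt]; constructor <;> linarith))
    have hb := abs_lt.1 (hc (x := x + δ / 2) (by
      rw [Real.dist_eq, abs_lt]; constructor <;> linarith))
    -- On this interval both functions are trapped between their endpoint values: `G` varies by less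
    -- than `ε / 2`, and the endpoint errors of `F n` are below `ε / 2`.
    refine ⟨Set.Icc (x - δ / 2) (x + δ / 2), Icc_mem_nhds (by linarith) (by linarith), ?_⟩
    filter_upwards [(h (x - δ / 2)).eventually_lt_const (lt_add_of_pos_right _ (half_pos hε)),
      (h (x + δ / 2)).eventually_const_lt (sub_lt_self _ (half_pos hε))] with n h1 h2 y hy
    have e1 := hF n hy.1
    have e2 := hF n hy.2
    have e3 := hGanti hy.1
    have e4 := hGanti hy.2
    rw [Real.dist_eq, abs_lt]
    constructor <;> linarith
  rw [Metric.tendstoUniformly_iff]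
  intro ε hε
  -- Left of `A` both functions end up in `(1 - ε / 2, 1]` and right of `B` in `[0, ε / 2)`, so only
  -- the compact interval between them needs local uniformity.
  obtain ⟨A, hA⟩ := (hGbot.eventually_const_lt (sub_lt_self 1 (half_pos hε))).exists
  obtain ⟨B, hB⟩ := (hGtop.eventually_lt_const (half_pos hε)).exists
  have hunif := (tendstoLocallyUniformlyOn_iff_tendstoUniformlyOn_of_compact
    (isCompact_Icc (a := A) (b := B))).1 hloc.tendstoLocallyUniformlyOn
  rw [Metric.tendstoUniformlyOn_iff] at hunif
  filter_upwards [hunif ε hε, (h A).eventually_const_lt hA, (h B).eventually_lt_const hB]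
    with n hn hnA hnB x
  have hG0 : 0 ≤ G x := hGanti.le_of_tendsto hGtop x
  have hG1 : G x ≤ 1 := hGanti.ge_of_tendsto hGbot x
  have f0 := hF0 n x
  have f1 := hF1 n x
  rcases le_total x A with hxA | hxA
  · have e1 := hF n hxA
    have e2 := hGanti hxA
    rw [Real.dist_eq, abs_lt]
    constructor <;> linarith
  rcases le_total x B with hxB | hxB
  · exact hn x ⟨hxA, hxB⟩
  · have e1 := hF n hxB
    have e2 := hGanti hxB
    rw [Real.dist_eq, abs_lt]
    constructor <;> linarith

lemma tendstoUniformly_Q_div {s : ℕ → ℝ} {s₀ : ℝ} (hs₀ : 0 < s₀) (hs : ∀ n, 0 ≤ s n)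
    (h : Tendsto s atTop (𝓝 s₀)) :
    TendstoUniformly (fun n x ↦ Q (x / s n)) (fun x ↦ Q (x / s₀)) atTop :=
  tendstoUniformly_of_antitone
    (fun n ↦ fun _ _ hxy ↦ antitone_Q (div_le_div_of_nonneg_right hxy (hs n)))
    (fun _ _ ↦ Q_nonneg _) (fun _ _ ↦ Q_le_one _)
    (continuous_Q.comp (continuous_id.div_const _))
    (fun _ _ hxy ↦ antitone_Q (div_le_div_of_nonneg_right hxy hs₀.le))
    (tendsto_Q_atBot.comp (tendsto_id.atBot_div_const hs₀))
    (tendsto_Q_atTop.comp (tendsto_id.atTop_div_const hs₀))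
    (fun _ ↦ (continuous_Q.tendsto _).comp (tendsto_const_nhds.div h hs₀.ne'))

/-- Laws whose characteristic functions converge to the one of `N(0, v)` have tail functions that
converge uniformly to `x ↦ Q (x / √v)`. -/
lemma tendstoUniformly_tail_of_charFun {μ : ℕ → Measure ℝ} [∀ n, IsProbabilityMeasure (μ n)]
    {v : ℝ} (hv : 0 < v)
    (h : ∀ u : ℝ, Tendsto (fun n ↦ charFun (μ n) u) atTop
      (𝓝 (Complex.exp (-(v * u ^ 2 / 2 : ℝ))))) :
    TendstoUniformly (fun n x ↦ (μ n).real (Set.Ioi x)) (fun x ↦ Q (x / √v)) atTop := by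
  set w : ℝ≥0 := v.toNNReal with hw
  have hw0 : 0 < w := Real.toNNReal_pos.2 hv
  have hwv : (w : ℝ) = v := Real.coe_toNNReal _ hv.le
  let ν : ℕ → ProbabilityMeasure ℝ := fun n ↦ ⟨μ n, inferInstance⟩
  let γ : ProbabilityMeasure ℝ := ⟨gaussianReal 0 w, inferInstance⟩
  have hconv : Tendsto ν atTop (𝓝 γ) := by
    rw [ProbabilityMeasure.tendsto_iff_tendsto_charFun]
    intro u
    convert! h u using 2
    simp only [γ, ProbabilityMeasure.coe_mk, charFun_gaussianReal]
    congr 1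
    rw [← hwv]
    push_cast
    simp
  have hpos : 0 < √v := Real.sqrt_pos.2 hv
  have := nullSingletonClass_gaussianReal (μ := 0) hw0.ne'
  refine tendstoUniformly_of_antitone
    (fun n ↦ fun _ _ hxy ↦ measureReal_mono (Set.Ioi_subset_Ioi hxy))
    (fun _ _ ↦ measureReal_nonneg) (fun _ _ ↦ measureReal_le_one)
    (continuous_Q.comp (continuous_id.div_const _))
    (fun _ _ hxy ↦ antitone_Q (div_le_div_of_nonneg_right hxy hpos.le))
    (tendsto_Q_atBot.comp (tendsto_id.atBot_div_const hpos))
    (tendsto_Q_atTop.comp (tendsto_id.atTop_div_const hpos)) (fun x ↦ ?_)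
  -- The frontier of the half-line is a single point, which a nondegenerate Gaussian does not
  -- charge.
  have h1 := ProbabilityMeasure.tendsto_measure_of_null_frontier_of_tendsto' hconv
    (E := Set.Ioi x) (by simp [γ])
  have h2 := (ENNReal.tendsto_toReal (measure_ne_top (γ : Measure ℝ) _)).comp h1
  rw [← hwv, ← gaussianReal_real_Ioi hw0]
  exact h2

/-- The normal approximation with centering `c n` and scale `s n`. -/
lemma tendstoUniformly_tail_sub_Q {μ : ℕ → Measure ℝ} [∀ n, IsProbabilityMeasure (μ n)]
    {v : ℝ} (hv : 0 < v) {c s : ℕ → ℝ} (hs : ∀ n, 0 ≤ s n) (hsv : Tendsto s atTop (𝓝 √v))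
    (h : ∀ u : ℝ, Tendsto (fun n ↦ charFun ((μ n).map (· - c n)) u) atTop
      (𝓝 (Complex.exp (-(v * u ^ 2 / 2 : ℝ))))) :
    TendstoUniformly (fun n b ↦ (μ n).real (Set.Ioi b) - Q ((b - c n) / s n)) (fun _ ↦ 0)
      atTop := by
  have : ∀ n, IsProbabilityMeasure ((μ n).map (· - c n)) :=
    fun n ↦ Measure.isProbabilityMeasure_map (by fun_prop)
  have h1 := (tendstoUniformly_tail_of_charFun hv h).sub
    (tendstoUniformly_Q_div (Real.sqrt_pos.2 hv) hs hsv)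
  rw [Metric.tendstoUniformly_iff] at h1 ⊢
  intro ε hε
  -- Uniformity allows evaluation at the moving point `b - c n`.
  filter_upwards [h1 ε hε] with n hn b
  have := hn (b - c n)
  simp only [Pi.sub_apply, sub_self] at this
  rwa [map_measureReal_apply (by fun_prop) measurableSet_Ioi,
    show (fun x ↦ x - c n) ⁻¹' Set.Ioi (b - c n) = Set.Ioi b by ext; simp] at this

/-! ### Circularly symmetric complex Gaussian laws -/

lemma measurable_complex_mk : Measurable (fun p : ℝ × ℝ ↦ (⟨p.1, p.2⟩ : ℂ)) :=
  Complex.measurableEquivRealProd.symm.measurable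

instance (v : ℝ) : IsProbabilityMeasure (complexGaussian v) :=
  Measure.isProbabilityMeasure_map measurable_complex_mk.aemeasurable

lemma charFun_complexGaussian {v : ℝ} (hv : 0 ≤ v) (w : ℂ) :
    charFun (complexGaussian v) w = Complex.exp (-(v * ‖w‖ ^ 2 / 4 : ℝ)) := by
  have hc : (((v / 2).toNNReal : ℝ) : ℂ) = (v / 2 : ℂ) := by
    rw [Real.coe_toNNReal _ (by positivity)]; push_cast; rfl
  have h (x : ℝ × ℝ) : Complex.exp ((inner ℝ (⟨x.1, x.2⟩ : ℂ) w : ℝ) * Complex.I)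
      = Complex.exp (w.re * x.1 * Complex.I) * Complex.exp (w.im * x.2 * Complex.I) := by
    rw [← Complex.exp_add, Complex.inner]
    congr 1
    simp
    ring
  rw [complexGaussian, charFun_apply, integral_map measurable_complex_mk.aemeasurable
    (by fun_prop)]
  simp_rw [h]
  rw [integral_prod_mul (fun x : ℝ ↦ Complex.exp (w.re * x * Complex.I))
      (fun x : ℝ ↦ Complex.exp (w.im * x * Complex.I)), ← charFun_apply_real, ← charFun_apply_real,
    charFun_gaussianReal, charFun_gaussianReal, ← Complex.exp_add, hc, Complex.sq_norm,
    Complex.normSq_apply]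
  congr 1
  push_cast
  ring

/-! ### Linear combinations of independent complex Gaussian variables -/

section Linear

variable {ι κ : Type*} [Fintype ι] [Fintype κ]

/-- `Re (w x)` is the real inner product of `x` with `conj w`, so this is the characteristic
function of the product law at the conjugate vector. -/
lemma integral_exp_re_sum_complexGaussian {v : ι → ℝ} (hv : ∀ i, 0 ≤ v i) (w : ι → ℂ) :
    ∫ x, Complex.exp ((∑ i, w i * x i).re * Complex.I) ∂Measure.pi (fun i ↦ complexGaussian (v i))
      = Complex.exp (-((∑ i, v i * ‖w i‖ ^ 2) / 4 : ℝ)) := by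
  have h := charFun_pi (μ := fun i ↦ complexGaussian (v i))
    (WithLp.toLp 2 (fun i ↦ conj (w i)))
  rw [charFun_apply, integral_map (by fun_prop) (by fun_prop)] at h
  convert! h using 1
  · refine integral_congr_ae (ae_of_all _ fun x ↦ ?_)
    simp only [PiLp.inner_apply, Complex.re_sum]
    congr 3
    refine Finset.sum_congr rfl fun i _ ↦ ?_
    simp [Complex.inner]
  · simp_rw [charFun_complexGaussian (hv _), ← Complex.exp_sum]
    congr 1
    simp [Finset.sum_div]

/-- Uncorrelated linear images of independent circularly symmetric complex Gaussian variables are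
again independent circularly symmetric complex Gaussian variables. -/
lemma map_linear_complexGaussian [DecidableEq κ] {v : ι → ℝ} (hv : ∀ i, 0 ≤ v i) {u : κ → ℝ}
    (hu : ∀ j, 0 ≤ u j) (A : κ → ι → ℂ)
    (hA : ∀ j j', ∑ i, (v i : ℂ) * (A j i * conj (A j' i)) = if j = j' then (u j : ℂ) else 0) :
    (Measure.pi (fun i ↦ complexGaussian (v i))).map (fun x j ↦ ∑ i, A j i * x i)
      = Measure.pi (fun j ↦ complexGaussian (u j)) := by
  have hm : Measurable (fun (x : ι → ℂ) (j : κ) ↦ ∑ i, A j i * x i) := by fun_prop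
  have := Measure.isProbabilityMeasure_map
    (μ := Measure.pi (fun i ↦ complexGaussian (v i))) hm.aemeasurable
  rw [← charFun_eq_pi_iff]
  intro t
  have hL : Measurable (WithLp.toLp 2 : (κ → ℂ) → PiLp 2 fun _ : κ ↦ ℂ) :=
    (MeasurableEquiv.toLp 2 (κ → ℂ)).measurable
  rw [Measure.map_map hL hm, charFun_apply, integral_map (hL.comp hm).aemeasurable (by fun_prop)]
  have h (x : ι → ℂ) : inner ℝ ((WithLp.toLp 2 ∘ fun (x : ι → ℂ) (j : κ) ↦ ∑ i, A j i * x i) x) t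
      = (∑ i, (∑ j, conj (t j) * A j i) * x i).re := by
    have h1 (j : κ) : inner ℝ (∑ i, A j i * x i) (t j) = (conj (t j) * ∑ i, A j i * x i).re := by
      generalize ∑ i, A j i * x i = a
      simp [Complex.inner]
    simp only [PiLp.inner_apply, Function.comp_apply, h1, ← Complex.re_sum, Finset.sum_mul,
      Finset.mul_sum, mul_assoc]
    rw [Finset.sum_comm]
  simp_rw [h]
  rw [integral_exp_re_sum_complexGaussian hv]
  simp_rw [charFun_complexGaussian (hu _), ← Complex.exp_sum]
  congr 1
  rw [Finset.sum_neg_distrib, ← Complex.ofReal_sum, ← Finset.sum_div]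
  congr 3
  -- The variance of a combination of the outputs: by `hA` the cross terms vanish, so its
  -- characteristic function factors.
  have key : ∑ i, (v i : ℂ) * ((∑ j, conj (t j) * A j i) * conj (∑ j, conj (t j) * A j i))
      = ∑ j, (u j : ℂ) * (t j * conj (t j)) := by
    calc _ = ∑ i, ∑ j, ∑ j', conj (t j) * t j' * ((v i : ℂ) * (A j i * conj (A j' i))) := by
          refine Finset.sum_congr rfl fun i _ ↦ ?_
          rw [map_sum, Finset.sum_mul_sum, Finset.mul_sum]
          refine Finset.sum_congr rfl fun j _ ↦ ?_
          rw [Finset.mul_sum]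
          refine Finset.sum_congr rfl fun j' _ ↦ ?_
          rw [map_mul, Complex.conj_conj]; ring
      _ = ∑ j, ∑ j', conj (t j) * t j' * ∑ i, (v i : ℂ) * (A j i * conj (A j' i)) := by
          rw [Finset.sum_comm]
          refine Finset.sum_congr rfl fun j _ ↦ ?_
          rw [Finset.sum_comm]
          simp_rw [Finset.mul_sum]
      _ = _ := by
          simp_rw [hA, mul_ite, mul_zero, Finset.sum_ite_eq, Finset.mem_univ, if_true]
          exact Finset.sum_congr rfl fun j _ ↦ by ring
  simp_rw [Complex.mul_conj, Complex.normSq_eq_norm_sq] at key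
  exact_mod_cast key

/-- A linear combination of complex Gaussian variables whose random coefficients are independent of
them and have almost surely the same total variance adds an independent Gaussian variable. -/
lemma charFun_map_add_re_sum {E : Type*} [MeasurableSpace E] {μ : Measure E}
    [IsProbabilityMeasure μ] {v : ι → ℝ} (hv : ∀ i, 0 ≤ v i) {f : E → ℝ} (hf : Measurable f)
    {w : E → ι → ℂ} (hw : Measurable w) {s : ℝ}
    (hs : ∀ᵐ x ∂μ, ∑ i, v i * ‖w x i‖ ^ 2 = s) (r : ℝ) :
    charFun ((μ.prod (Measure.pi (fun i ↦ complexGaussian (v i)))).map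
        (fun p ↦ f p.1 + (∑ i, w p.1 i * p.2 i).re)) r
      = charFun (μ.map f) r * Complex.exp (-(s * r ^ 2 / 4 : ℝ)) := by
  have hw' (i : ι) : Measurable (fun x ↦ w x i) := hw.eval
  have hm : Measurable (fun p : E × (ι → ℂ) ↦ f p.1 + (∑ i, w p.1 i * p.2 i).re) := by
    fun_prop
  rw [charFun_apply_real, charFun_apply_real, integral_map hm.aemeasurable (by fun_prop),
    integral_map hf.aemeasurable (by fun_prop), integral_prod, ← integral_mul_const]
  · refine integral_congr_ae ?_
    -- For fixed `x` the inner integral is Gaussian with a value that does not depend on `x`, so it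
    -- leaves the outer integral as a factor.
    filter_upwards [hs] with x hx
    have h (y : ι → ℂ) : Complex.exp (r * (f x + (∑ i, w x i * y i).re : ℝ) * Complex.I)
        = Complex.exp (r * f x * Complex.I)
          * Complex.exp ((∑ i, (r * w x i) * y i).re * Complex.I) := by
      rw [← Complex.exp_add]
      congr 1
      simp_rw [mul_assoc, ← Finset.mul_sum, Complex.re_ofReal_mul]
      push_cast
      ring
    simp_rw [h]
    rw [integral_const_mul, integral_exp_re_sum_complexGaussian hv, ← hx]
    congr 4
    rw [Finset.sum_mul]
    congr 1
    refine Finset.sum_congr rfl fun i _ ↦ ?_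
    rw [norm_mul, mul_pow, Complex.norm_real, Real.norm_eq_abs, sq_abs]
    ring
  · refine Integrable.of_bound (C := 1) (by fun_prop) (ae_of_all _ fun p ↦ ?_)
    rw [← Complex.ofReal_mul, Complex.norm_exp_ofReal_mul_I]

end Linear

/-! ### Moments -/

lemma integral_pow_four_gaussianReal (v : ℝ≥0) :
    ∫ x, x ^ 4 ∂gaussianReal 0 v = 3 * (v : ℝ) ^ 2 := by
  have h := iteratedDeriv_mgf_zero (X := id) (μ := gaussianReal 0 v)
    (by simp) 4
  simp only [Pi.pow_apply, id] at h
  rw [← h, mgf_id_gaussianReal]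
  simp only [zero_mul, zero_add]
  -- The fourth moment is the fourth derivative of the moment generating function at `0`; each
  -- derivative is again a polynomial times the same exponential.
  have hd (p p' : ℝ → ℝ) (hp : ∀ t, HasDerivAt p (p' t) t) :
      deriv (fun t ↦ p t * Real.exp (v * t ^ 2 / 2))
        = fun t ↦ (p' t + p t * (v * t)) * Real.exp (v * t ^ 2 / 2) := by
    ext t
    have h2 : HasDerivAt (fun t : ℝ ↦ v * t ^ 2 / 2) (v * t) t := by
      convert! (((hasDerivAt_id t).pow 2).const_mul (v : ℝ)).div_const 2 using 1
      simp; ring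
    refine ((hp t).mul h2.exp).deriv.trans ?_
    ring
  have h1 : deriv (fun t : ℝ ↦ Real.exp (v * t ^ 2 / 2))
      = fun t ↦ (v * t) * Real.exp (v * t ^ 2 / 2) := by
    simpa using hd (fun _ ↦ 1) (fun _ ↦ 0) (fun t ↦ hasDerivAt_const _ _)
  have d1 (t : ℝ) : HasDerivAt (fun t : ℝ ↦ (v : ℝ) * t) v t := by
    simpa using (hasDerivAt_id t).const_mul (v : ℝ)
  have d2 (t : ℝ) : HasDerivAt (fun t : ℝ ↦ (v : ℝ) + v * t * (v * t)) (2 * v ^ 2 * t) t := by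
    convert! ((d1 t).mul (d1 t)).const_add (v : ℝ) using 1; ring
  have d3 (t : ℝ) : HasDerivAt
      (fun t : ℝ ↦ 2 * (v : ℝ) ^ 2 * t + (v + v * t * (v * t)) * (v * t))
      (3 * v ^ 2 + 3 * v ^ 3 * t ^ 2) t := by
    convert! ((hasDerivAt_id t).const_mul (2 * (v : ℝ) ^ 2)).add ((d2 t).mul (d1 t)) using 1; ring
  simp only [iteratedDeriv_succ, iteratedDeriv_zero]
  rw [h1, hd _ _ d1, hd _ _ d2, hd _ _ d3]
  simp

lemma integral_sq_gaussianReal (v : ℝ≥0) : ∫ x, x ^ 2 ∂gaussianReal 0 v = v := by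
  have h := variance_id_gaussianReal (μ := 0) (v := v)
  rw [variance_eq_integral (by fun_prop)] at h
  simpa using h

lemma integrable_pow_gaussianReal (v : ℝ≥0) (n : ℕ) :
    Integrable (fun x ↦ x ^ n) (gaussianReal 0 v) := by
  rcases Nat.eq_zero_or_pos n with rfl | hn
  · simp
  have h := (memLp_id_gaussianReal (μ := 0) (v := v) n).integrable_norm_pow hn.ne'
  refine h.mono' (by fun_prop) (ae_of_all _ fun x ↦ by simp)

lemma integral_normSq_complexGaussian {v : ℝ} (hv : 0 ≤ v) :
    Integrable (fun z : ℂ ↦ ‖z‖ ^ 2) (complexGaussian v) ∧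
      ∫ z, ‖z‖ ^ 2 ∂complexGaussian v = v := by
  have i1 := (integrable_pow_gaussianReal (v / 2).toNNReal 2).comp_fst
    (gaussianReal 0 (v / 2).toNNReal)
  have i2 := (integrable_pow_gaussianReal (v / 2).toNNReal 2).comp_snd
    (gaussianReal 0 (v / 2).toNNReal)
  have h (x : ℝ × ℝ) : ‖(⟨x.1, x.2⟩ : ℂ)‖ ^ 2 = x.1 ^ 2 + x.2 ^ 2 := by
    rw [Complex.sq_norm, Complex.normSq_apply]; ring
  rw [complexGaussian, integrable_map_measure (by fun_prop) measurable_complex_mk.aemeasurable,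
    integral_map measurable_complex_mk.aemeasurable (by fun_prop)]
  simp only [Function.comp_def, h]
  refine ⟨i1.add i2, ?_⟩
  rw [integral_add i1 i2, integral_fun_fst (fun x : ℝ ↦ x ^ 2),
    integral_fun_snd (fun x : ℝ ↦ x ^ 2), integral_sq_gaussianReal,
    Real.coe_toNNReal _ (by positivity)]
  simp

lemma integral_norm_pow_four_complexGaussian {v : ℝ} (hv : 0 ≤ v) :
    Integrable (fun z : ℂ ↦ ‖z‖ ^ 4) (complexGaussian v) ∧
      ∫ z, ‖z‖ ^ 4 ∂complexGaussian v = 2 * v ^ 2 := by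
  have i1 := (integrable_pow_gaussianReal (v / 2).toNNReal 4).comp_fst
    (gaussianReal 0 (v / 2).toNNReal)
  have i2 := (integrable_pow_gaussianReal (v / 2).toNNReal 4).comp_snd
    (gaussianReal 0 (v / 2).toNNReal)
  have i3 := ((integrable_pow_gaussianReal (v / 2).toNNReal 2).mul_prod
    (integrable_pow_gaussianReal (v / 2).toNNReal 2)).const_mul 2
  have h (x : ℝ × ℝ) : ‖(⟨x.1, x.2⟩ : ℂ)‖ ^ 4 = x.1 ^ 4 + x.2 ^ 4 + 2 * (x.1 ^ 2 * x.2 ^ 2) := by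
    rw [show ‖(⟨x.1, x.2⟩ : ℂ)‖ ^ 4 = (‖(⟨x.1, x.2⟩ : ℂ)‖ ^ 2) ^ 2 by ring,
      Complex.sq_norm, Complex.normSq_apply]; ring
  rw [complexGaussian, integrable_map_measure (by fun_prop) measurable_complex_mk.aemeasurable,
    integral_map measurable_complex_mk.aemeasurable (by fun_prop)]
  simp only [Function.comp_def, h]
  refine ⟨(i1.add i2).add i3, ?_⟩
  rw [integral_add (f := fun x : ℝ × ℝ ↦ x.1 ^ 4 + x.2 ^ 4) (i1.add i2) i3,
    integral_add i1 i2, integral_fun_fst (fun x : ℝ ↦ x ^ 4),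
    integral_fun_snd (fun x : ℝ ↦ x ^ 4), integral_const_mul,
    integral_prod_mul (fun x : ℝ ↦ x ^ 2) (fun x : ℝ ↦ x ^ 2), integral_sq_gaussianReal,
    integral_pow_four_gaussianReal, Real.coe_toNNReal _ (by positivity)]
  simp
  ring

/-! ### Fluctuations of the norm of a complex Gaussian vector -/

lemma vnorm_sq {n : ℕ} (y : Fin n → ℂ) : vnorm y ^ 2 = ∑ m, ‖y m‖ ^ 2 := by
  rw [vnorm, EuclideanSpace.norm_sq_eq]

lemma vnorm_nonneg {n : ℕ} (y : Fin n → ℂ) : 0 ≤ vnorm y := norm_nonneg _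

@[fun_prop]
lemma measurable_vnorm {n : ℕ} : Measurable (vnorm : (Fin n → ℂ) → ℝ) :=
  measurable_norm.comp (MeasurableEquiv.toLp 2 (Fin n → ℂ)).measurable

/-- The centered and normalized squared modulus. -/
noncomputable def excess (N : ℝ) (z : ℂ) : ℝ := ‖z‖ ^ 2 / N - 1

@[fun_prop]
lemma measurable_excess (N : ℝ) : Measurable (excess N) := by
  unfold excess; fun_prop

lemma integrable_excess_sq {N : ℝ} (hN : 0 < N) :
    Integrable (fun z ↦ excess N z ^ 2) (complexGaussian N) := by
  have h2 := (integral_normSq_complexGaussian hN.le).1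
  have h4 := (integral_norm_pow_four_complexGaussian hN.le).1
  refine (((h4.const_mul (1 / N ^ 2)).sub (h2.const_mul (2 / N))).add
    (integrable_const (1 : ℝ))).congr (ae_of_all _ fun z ↦ ?_)
  simp only [Pi.add_apply, Pi.sub_apply, excess]
  field_simp
  ring

lemma integral_excess {N : ℝ} (hN : 0 < N) : ∫ z, excess N z ∂complexGaussian N = 0 := by
  have h2 := integral_normSq_complexGaussian hN.le
  simp only [excess]
  rw [integral_sub (h2.1.div_const N) (integrable_const _), integral_div, h2.2]
  simp [hN.ne']

lemma integral_excess_sq {N : ℝ} (hN : 0 < N) : ∫ z, excess N z ^ 2 ∂complexGaussian N = 1 := by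
  have h2 := integral_normSq_complexGaussian hN.le
  have h4 := integral_norm_pow_four_complexGaussian hN.le
  have h (z : ℂ) : excess N z ^ 2 = 1 / N ^ 2 * ‖z‖ ^ 4 - 2 / N * ‖z‖ ^ 2 + 1 := by
    rw [excess]; field_simp; ring
  simp_rw [h]
  rw [integral_add (f := fun z : ℂ ↦ 1 / N ^ 2 * ‖z‖ ^ 4 - 2 / N * ‖z‖ ^ 2)
      ((h4.1.const_mul _).sub (h2.1.const_mul _)) (integrable_const _),
    integral_sub (h4.1.const_mul _) (h2.1.const_mul _), integral_const_mul, integral_const_mul,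
    h2.2, h4.2]
  simp
  field_simp
  norm_num

lemma memLp_excess {N : ℝ} (hN : 0 < N) : MemLp (excess N) 2 (complexGaussian N) :=
  (memLp_two_iff_integrable_sq (by fun_prop)).2 (integrable_excess_sq hN)

variable {M : ℕ} {N : ℝ}

lemma integrable_sum_excess_sq (hN : 0 < N) :
    Integrable (fun y : Fin M → ℂ ↦ (∑ m, excess N (y m)) ^ 2)
      (Measure.pi fun _ ↦ complexGaussian N) := by
  have h : MemLp (fun y : Fin M → ℂ ↦ ∑ m, excess N (y m)) 2
      (Measure.pi fun _ ↦ complexGaussian N) :=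
    memLp_finsetSum _ fun m _ ↦ (memLp_excess hN).comp_measurePreserving
      (measurePreserving_eval (fun _ : Fin M ↦ complexGaussian N) m)
  exact h.integrable_sq

lemma integral_sum_excess_sq (hN : 0 < N) :
    ∫ y : Fin M → ℂ, (∑ m, excess N (y m)) ^ 2 ∂Measure.pi (fun _ ↦ complexGaussian N) = M := by
  have hmp (m : Fin M) := measurePreserving_eval (fun _ : Fin M ↦ complexGaussian N) m
  have h := variance_sum_pi (μ := fun _ : Fin M ↦ complexGaussian N)
    (X := fun _ ↦ excess N) (fun _ ↦ memLp_excess hN)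
  have h0 : Var[excess N; complexGaussian N] = 1 := by
    rw [variance_of_integral_eq_zero (by fun_prop) (integral_excess hN), ← integral_excess_sq hN]
  have hE : ∫ y : Fin M → ℂ, ∑ m, excess N (y m) ∂Measure.pi (fun _ ↦ complexGaussian N) = 0 := by
    rw [integral_finsetSum]
    · refine Finset.sum_eq_zero fun m _ ↦ ?_
      have := integral_map (φ := Function.eval m) (hmp m).aemeasurable (f := excess N)
        (measurable_excess N).aestronglyMeasurable
      rw [(hmp m).map_eq, integral_excess hN] at this
      exact this.symm
    · intro m _
      exact (hmp m).integrable_comp_of_integrable ((memLp_excess hN).integrable (by norm_num))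
  rw [show (∑ i : Fin M, fun ω : Fin M → ℂ ↦ excess N (ω i))
    = fun ω : Fin M → ℂ ↦ ∑ i, excess N (ω i) by ext; simp,
    variance_of_integral_eq_zero (Measurable.aemeasurable (by fun_prop)) hE] at h
  simpa [h0] using h

/-- With `R = ‖y‖ / √N` and `c = √M` the sum of excesses is `R² - c²`. The linearization error is
exactly `-(R - c)² / (2c)`, and `|R - c| ≤ |R² - c²| / c` since `R + c ≥ c`. -/
lemma abs_vnorm_sub_le (hN : 0 < N) (hM : 0 < M) (y : Fin M → ℂ) :
    |vnorm y / √N - √M - (∑ m, excess N (y m)) / (2 * √M)|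
      ≤ (∑ m, excess N (y m)) ^ 2 / (2 * M * √M) := by
  have hM' : (0 : ℝ) < √M := Real.sqrt_pos.2 (by exact_mod_cast hM)
  have hMs : √(M : ℝ) ^ 2 = M := Real.sq_sqrt (by positivity)
  have hN' : (0 : ℝ) < √N := Real.sqrt_pos.2 hN
  have hR : 0 ≤ vnorm y / √N := div_nonneg (vnorm_nonneg y) hN'.le
  have hS : ∑ m, excess N (y m) = (vnorm y / √N) ^ 2 - √M ^ 2 := by
    rw [div_pow, Real.sq_sqrt hN.le, vnorm_sq, hMs]
    simp [excess, Finset.sum_div]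
  rw [hS]
  generalize vnorm y / √N = R at *
  generalize √(M : ℝ) = c at *
  rw [← hMs]
  have h1 : R - c - (R ^ 2 - c ^ 2) / (2 * c) = - ((R - c) ^ 2 / (2 * c)) := by
    field_simp; ring
  rw [h1, abs_neg, abs_of_nonneg (by positivity), div_le_div_iff₀ (by positivity) (by positivity)]
  have h2 : (R ^ 2 - c ^ 2) ^ 2 = (R - c) ^ 2 * (R + c) ^ 2 := by ring
  have h3 : c ^ 2 ≤ (R + c) ^ 2 := by gcongr; linarith
  rw [h2]
  calc (R - c) ^ 2 * (2 * c ^ 2 * c) = (R - c) ^ 2 * c ^ 2 * (2 * c) := by ring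
    _ ≤ (R - c) ^ 2 * (R + c) ^ 2 * (2 * c) := by gcongr

/-- The central limit theorem for the excesses, which are centred with unit variance; the extra
factor `1 / 2` turns variance `1` into `1 / 4`. -/
lemma tendsto_charFun_sum_excess (hN : 0 < N) (r : ℝ) :
    Tendsto (fun M : ℕ ↦ ∫ y : Fin M → ℂ,
        Complex.exp ((r * ((∑ m, excess N (y m)) / (2 * √M)) : ℝ) * Complex.I)
          ∂Measure.pi (fun _ ↦ complexGaussian N))
      atTop (𝓝 (Complex.exp (-(r ^ 2 / 8 : ℝ)))) := by
  have h := tendsto_charFun_inv_sqrt_mul_pow (P := complexGaussian N) (X := excess N)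
    (by fun_prop) (integral_excess hN) (integral_excess_sq hN) (r / 2)
  convert! h using 2 with M
  · have hpow := integral_fintype_prod_eq_pow (ι := Fin M) (μ := complexGaussian N)
      (fun z ↦ Complex.exp (((√M)⁻¹ * (r / 2) : ℝ) * excess N z * Complex.I))
    rw [Fintype.card_fin] at hpow
    rw [charFun_apply_real, integral_map (measurable_excess N).aemeasurable (by fun_prop), ← hpow]
    refine integral_congr_ae (ae_of_all _ fun y ↦ ?_)
    simp only [← Complex.exp_sum, ← Finset.sum_mul, ← Finset.mul_sum, ← Complex.ofReal_sum]
    congr 2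
    push_cast
    ring
  · congr 1
    push_cast
    ring

/-- The map `a ↦ exp (i a)` is `1`-Lipschitz. -/
lemma norm_integral_exp_sub_le {Ω : Type*} [MeasurableSpace Ω] {P : Measure Ω}
    [IsProbabilityMeasure P] {f g h : Ω → ℝ} (hf : Measurable f) (hg : Measurable g)
    (hh : Integrable h P) (hle : ∀ x, |f x - g x| ≤ h x) :
    ‖∫ x, Complex.exp (f x * Complex.I) ∂P - ∫ x, Complex.exp (g x * Complex.I) ∂P‖
      ≤ ∫ x, h x ∂P := by
  have hi {f : Ω → ℝ} (hf : Measurable f) : Integrable (fun x ↦ Complex.exp (f x * Complex.I)) P :=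
    Integrable.of_bound (C := 1) (by fun_prop)
      (ae_of_all _ fun p ↦ by rw [Complex.norm_exp_ofReal_mul_I])
  rw [← integral_sub (hi hf) (hi hg)]
  refine norm_integral_le_of_norm_le hh (ae_of_all _ fun x ↦ ?_)
  have : Complex.exp (f x * Complex.I) - Complex.exp (g x * Complex.I)
      = Complex.exp (g x * Complex.I) * (Complex.exp (Complex.I * (f x - g x : ℝ)) - 1) := by
    rw [mul_sub, ← Complex.exp_add, mul_one]
    congr 2
    push_cast; ring
  rw [this, norm_mul, Complex.norm_exp_ofReal_mul_I, one_mul]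
  exact Real.norm_exp_I_mul_ofReal_sub_one_le.trans (by rw [Real.norm_eq_abs]; exact hle x)

/-- The norm of a complex Gaussian vector, centered at `√(N M)`, is asymptotically normal with
variance `N / 4`. -/
lemma tendsto_charFun_vnorm (hN : 0 < N) (r : ℝ) :
    Tendsto (fun M : ℕ ↦ ∫ y : Fin M → ℂ,
        Complex.exp ((r * (vnorm y / √N - √M) : ℝ) * Complex.I)
          ∂Measure.pi (fun _ ↦ complexGaussian N))
      atTop (𝓝 (Complex.exp (-(r ^ 2 / 8 : ℝ)))) := by
  refine (tendsto_charFun_sum_excess hN r).congr_dist ?_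
  -- The squared sum of excesses has mean `M`, so the expected linearization error is `M / (2 M
  -- √M)`.
  have h : Tendsto (fun M : ℕ ↦ |r| / 2 / √(M : ℝ)) atTop (𝓝 0) :=
    tendsto_const_nhds.div_atTop (Real.tendsto_sqrt_atTop.comp tendsto_natCast_atTop_atTop)
  refine squeeze_zero' (Eventually.of_forall fun _ ↦ dist_nonneg) ?_ h
  filter_upwards [eventually_gt_atTop 0] with M hM
  rw [dist_comm, dist_eq_norm]
  have hM' : (0 : ℝ) < M := by exact_mod_cast hM
  refine (norm_integral_exp_sub_le (by fun_prop) (by fun_prop)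
    (((integrable_sum_excess_sq hN).div_const (2 * M * √M)).const_mul |r|) fun y ↦ ?_).trans ?_
  · rw [← mul_sub, abs_mul]
    exact mul_le_mul_of_nonneg_left (abs_vnorm_sub_le hN hM y) (abs_nonneg r)
  · rw [integral_const_mul, integral_div, integral_sum_excess_sq hN]
    apply le_of_eq
    have : √(M : ℝ) ≠ 0 := (Real.sqrt_pos.2 hM').ne'
    field_simp

/-! ### Sums over the sources -/

namespace Source

variable {K L J : Type*} {τ M : ℕ}

/-- The sources as a disjoint union of index types. -/
def equivSum : (K × Fin M) ⊕ (L × Fin M) ⊕ (J × Fin M) ⊕ (Fin M × Fin τ) ⊕ Fin τ ⊕ Fin τ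
    ≃ Source K L J τ M where
  toFun
    | .inl (i, m) => .channel i m
    | .inr (.inl (l, m)) => .dataChannel l m
    | .inr (.inr (.inl (j, m))) => .pilotChannel j m
    | .inr (.inr (.inr (.inl (m, s)))) => .ulNoise m s
    | .inr (.inr (.inr (.inr (.inl s)))) => .dlInterference s
    | .inr (.inr (.inr (.inr (.inr s)))) => .dlNoise s
  invFun
    | .channel i m => .inl (i, m)
    | .dataChannel l m => .inr (.inl (l, m))
    | .pilotChannel j m => .inr (.inr (.inl (j, m)))
    | .ulNoise m s => .inr (.inr (.inr (.inl (m, s))))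
    | .dlInterference s => .inr (.inr (.inr (.inr (.inl s))))
    | .dlNoise s => .inr (.inr (.inr (.inr (.inr s))))
  left_inv := by rintro (_ | _ | _ | _ | _ | _) <;> rfl
  right_inv := by rintro (_ | _ | _ | _ | _ | _) <;> rfl

variable [Fintype K] [Fintype L] [Fintype J]

instance : Fintype (Source K L J τ M) := Fintype.ofEquiv _ equivSum

lemma sum_eq (f : Source K L J τ M → ℂ) :
    ∑ s, f s = (∑ i, ∑ m, f (.channel i m)) + (∑ l, ∑ m, f (.dataChannel l m))
      + (∑ j, ∑ m, f (.pilotChannel j m)) + (∑ m, ∑ s, f (.ulNoise m s))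
      + (∑ s, f (.dlInterference s)) + ∑ s, f (.dlNoise s) := by
  rw [← equivSum.sum_comp]
  simp only [Fintype.sum_sum_type, Fintype.sum_prod_type, equivSum, Equiv.coe_fn_mk]
  ring

end Source

/-! ### The correlated signals as linear combinations of the sources -/

namespace Cell

variable {K L J : Type*} {τ M : ℕ} (S : Cell K L J τ)

lemma tau_pos (t : Fin τ) : (0 : ℝ) < τ := by exact_mod_cast t.pos

lemma vnorm_eq_sqrt {ψ : Fin τ → ℂ} (h : ∑ j, ψ j * conj (ψ j) = (τ : ℂ)) :
    vnorm ψ = √(τ : ℝ) := by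
  rw [← Real.sqrt_sq (vnorm_nonneg ψ), vnorm_sq]
  congr 1
  simp_rw [Complex.mul_conj, Complex.normSq_eq_norm_sq] at h
  exact_mod_cast h

lemma vnorm_ψ (t : Fin τ) : vnorm (S.ψ t) = √(τ : ℝ) :=
  vnorm_eq_sqrt (by simpa using S.ψ_orth t t)

lemma vnorm_φ (t : Fin τ) : vnorm (S.φ t) = √(τ : ℝ) :=
  vnorm_eq_sqrt (by simpa using S.φ_orth t t)

lemma sum_mul_conj_div_sqrt {ψ : Fin τ → Fin τ → ℂ}
    (h : ∀ s t, ∑ j, ψ s j * conj (ψ t j) = if s = t then (τ : ℂ) else 0) (s t : Fin τ) :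
    ∑ j, ψ s j * (conj (ψ t j) / (√(τ : ℝ) : ℂ)) = if s = t then (√(τ : ℝ) : ℂ) else 0 := by
  have hτ := tau_pos t
  have h0 : (√(τ : ℝ) : ℂ) ≠ 0 := by exact_mod_cast (Real.sqrt_pos.2 hτ).ne'
  simp_rw [← mul_div_assoc]
  rw [← Finset.sum_div, h]
  split_ifs
  · rw [div_eq_iff h0, ← Complex.ofReal_mul, Real.mul_self_sqrt hτ.le, Complex.ofReal_natCast]
  · simp

/-- The weight with which UE `i` contributes to the signal on pilot `t`. -/
noncomputable def ueWeight (t : Fin τ) (i : K) : ℝ :=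
  if S.c i = t then √(S.ρ i) * √(τ : ℝ) else 0

/-- The weight with which a data interferer contributes to the signal on pilot `t`. -/
noncomputable def dataWeight (t : Fin τ) (l : L) : ℂ :=
  ∑ s, S.d l s * (conj (S.ψ t s) / (√(τ : ℝ) : ℂ))

/-- The weight with which a pilot interferer contributes to the signal on pilot `t`. -/
noncomputable def pilotWeight (t : Fin τ) (j : J) : ℝ :=
  if S.ci j = t then √(S.ρi j) * √(τ : ℝ) else 0

/-- The coefficients of `[y_t]_m` as a linear combination of the sources. -/
noncomputable def ulCoeff (t : Fin τ) (m : Fin M) : Source K L J τ M → ℂ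
  | .channel i m' => if m = m' then S.ueWeight t i else 0
  | .dataChannel l m' => if m = m' then S.dataWeight t l else 0
  | .pilotChannel j m' => if m = m' then S.pilotWeight t j else 0
  | .ulNoise m' s => if m = m' then conj (S.ψ t s) / (√(τ : ℝ) : ℂ) else 0
  | .dlInterference _ => 0
  | .dlNoise _ => 0

/-- The coefficients of the downlink noise after correlation with the pilot `t`. -/
noncomputable def dlCoeff (t : Fin τ) : Source K L J τ M → ℂ
  | .dlInterference s => conj (S.φ t s) / (√(τ : ℝ) : ℂ)
  | .dlNoise s => conj (S.φ t s) / (√(τ : ℝ) : ℂ)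
  | _ => 0

open Classical in
/-- The coefficients of `[h_k]_m`. -/
noncomputable def chCoeff (k : K) (m : Fin M) : Source K L J τ M → ℂ :=
  Pi.single (.channel k m) 1

variable [Fintype K] [Fintype L] [Fintype J]

/-- Orthogonality of the uplink pilots removes every transmitter on another pilot; data interferers
keep their projection on `ψ_t`. -/
lemma y_eq_sum (t : Fin τ) (m : Fin M) (x : Source K L J τ M → ℂ) :
    S.y x t m = ∑ s, S.ulCoeff t m s * x s := by
  have hUE (i : K) : ∑ s, (√(S.ρ i) : ℂ) * x (.channel i m) * S.ψ (S.c i) s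
      * (conj (S.ψ t s) / (√(τ : ℝ) : ℂ)) = S.ueWeight t i * x (.channel i m) := by
    simp_rw [mul_assoc]
    rw [← Finset.mul_sum, ← Finset.mul_sum, sum_mul_conj_div_sqrt S.ψ_orth, ueWeight]
    split_ifs
    · push_cast; ring
    · simp
  have hP (j : J) : ∑ s, (√(S.ρi j) : ℂ) * x (.pilotChannel j m) * S.ψ (S.ci j) s
      * (conj (S.ψ t s) / (√(τ : ℝ) : ℂ)) = S.pilotWeight t j * x (.pilotChannel j m) := by
    simp_rw [mul_assoc]
    rw [← Finset.mul_sum, ← Finset.mul_sum, sum_mul_conj_div_sqrt S.ψ_orth, pilotWeight]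
    split_ifs
    · push_cast; ring
    · simp
  have hD (l : L) : ∑ s, x (.dataChannel l m) * S.d l s
      * (conj (S.ψ t s) / (√(τ : ℝ) : ℂ)) = S.dataWeight t l * x (.dataChannel l m) := by
    simp_rw [mul_assoc]
    rw [← Finset.mul_sum, dataWeight, mul_comm]
  rw [Source.sum_eq]
  simp only [y, Y, W, vnorm_ψ, ulCoeff, ite_mul, zero_mul, Finset.sum_ite_eq, Finset.mem_univ,
    if_true, Finset.sum_const_zero, add_zero, Finset.sum_ite_irrel]
  simp only [add_mul, Finset.sum_add_distrib, Finset.sum_mul]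
  rw [Finset.sum_comm (s := Finset.univ (α := Fin τ)) (t := Finset.univ (α := K)),
    Finset.sum_comm (s := Finset.univ (α := Fin τ)) (t := Finset.univ (α := L)),
    Finset.sum_comm (s := Finset.univ (α := Fin τ)) (t := Finset.univ (α := J))]
  simp_rw [hUE, hP, hD, mul_comm (x _)]
  ring

lemma chCoeff_sum (k : K) (m : Fin M) (x : Source K L J τ M → ℂ) :
    ∑ s, chCoeff k m s * x s = x (.channel k m) := by
  classical
  simp [chCoeff, Pi.single_apply]

/-! ### Second moments -/

/-- The covariance of two linear combinations of the sources. -/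
noncomputable def cov (k : K) (f g : Source K L J τ M → ℂ) : ℂ :=
  ∑ s, (S.sourceVar k s : ℂ) * (f s * conj (g s))

lemma cov_conj (k : K) (f g : Source K L J τ M → ℂ) : S.cov k g f = conj (S.cov k f g) := by
  simp [cov, mul_comm]

lemma cov_sub_smul_right (k : K) (c : ℝ) (f g g' : Source K L J τ M → ℂ) :
    S.cov k f (fun s ↦ g s - c * g' s) = S.cov k f g - c * S.cov k f g' := by
  simp only [cov, Finset.mul_sum, ← Finset.sum_sub_distrib]
  refine Finset.sum_congr rfl fun s _ ↦ ?_
  simp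
  ring

lemma cov_sub_smul_left (k : K) (c : ℝ) (f f' g : Source K L J τ M → ℂ) :
    S.cov k (fun s ↦ f s - c * f' s) g = S.cov k f g - c * S.cov k f' g := by
  rw [cov_conj, cov_sub_smul_right, cov_conj, S.cov_conj k f' g]
  simp

lemma cov_chCoeff (k : K) (m : Fin M) (g : Source K L J τ M → ℂ) :
    S.cov k (chCoeff k m) g = S.β k * conj (g (.channel k m)) := by
  classical
  simp [cov, chCoeff, Pi.single_apply, sourceVar]

lemma cov_chCoeff_chCoeff (k : K) (m m' : Fin M) :
    S.cov k (chCoeff k m) (chCoeff k m') = if m = m' then (S.β k : ℂ) else 0 := by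
  classical
  rw [cov_chCoeff]
  simp [chCoeff, Pi.single_apply]

lemma cov_chCoeff_ulCoeff (k : K) (t : Fin τ) (m m' : Fin M) :
    S.cov k (chCoeff k m) (S.ulCoeff t m') = if m = m' then (S.β k * S.ueWeight t k : ℂ) else 0 := by
  rw [cov_chCoeff, ulCoeff]
  by_cases h : m = m'
  · simp [h]
  · simp [h, Ne.symm h]

lemma cov_chCoeff_dlCoeff (k : K) (t : Fin τ) (m : Fin M) :
    S.cov k (chCoeff k m) (S.dlCoeff t) = 0 := by
  rw [cov_chCoeff]
  simp [dlCoeff]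

lemma cov_ulCoeff_dlCoeff (k : K) (t : Fin τ) (m : Fin M) :
    S.cov k (S.ulCoeff t m) (S.dlCoeff t) = 0 := by
  rw [cov, Source.sum_eq]
  simp [dlCoeff, ulCoeff]

lemma sum_norm_sq_div_sqrt {ψ : Fin τ → Fin τ → ℂ}
    (h : ∀ s t, ∑ j, ψ s j * conj (ψ t j) = if s = t then (τ : ℂ) else 0) (t : Fin τ) :
    ∑ s, conj (ψ t s) / (√(τ : ℝ) : ℂ) * conj (conj (ψ t s) / (√(τ : ℝ) : ℂ)) = 1 := by
  have hτ := tau_pos t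
  have h0 : (√(τ : ℝ) : ℂ) ≠ 0 := by exact_mod_cast (Real.sqrt_pos.2 hτ).ne'
  have := sum_mul_conj_div_sqrt h t t
  rw [if_pos rfl] at this
  rw [← div_self h0, ← this, Finset.sum_div]
  rw [this]
  refine Finset.sum_congr rfl fun s _ ↦ ?_
  simp
  ring

lemma cov_dlCoeff_dlCoeff (k : K) (t : Fin τ) :
    S.cov k (S.dlCoeff t : Source K L J τ M → ℂ) (S.dlCoeff t) = (S.Υ k + S.σ2 : ℝ) := by
  rw [cov, Source.sum_eq]
  simp only [dlCoeff, zero_mul, mul_zero, Finset.sum_const_zero, zero_add, sourceVar]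
  rw [← Finset.mul_sum, ← Finset.mul_sum, sum_norm_sq_div_sqrt S.φ_orth]
  push_cast; ring

/-- Identifies `α_t` as the noise-free variance of an entry of `y_t`. Silent UEs have weight `0`, so
summing over all UEs instead of the contenders changes nothing. -/
lemma alpha_eq (t : Fin τ) :
    S.α t = (∑ i, S.β i * S.ueWeight t i ^ 2) + (∑ l, S.βd l * ‖S.dataWeight t l‖ ^ 2)
      + ∑ j, S.βi j * S.pilotWeight t j ^ 2 := by
  have hτ := tau_pos t
  rw [α, ω, ← add_assoc]
  congr 1
  · congr 1
    · rw [contenders, Finset.sum_filter]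
      refine Finset.sum_congr rfl fun i _ ↦ ?_
      rw [ueWeight]
      by_cases h1 : S.c i = t
      · rw [if_pos h1, mul_pow, Real.sq_sqrt (S.ρ_nonneg i), Real.sq_sqrt hτ.le]
        by_cases h2 : 0 < S.ρ i
        · rw [if_pos ⟨h1, h2⟩]; ring
        · rw [if_neg (fun h ↦ h2 h.2), le_antisymm (not_lt.1 h2) (S.ρ_nonneg i)]; ring
      · rw [if_neg (fun h ↦ h1 h.1), if_neg h1]; ring
    · refine Finset.sum_congr rfl fun l _ ↦ ?_
      simp_rw [dataWeight, ← mul_div_assoc]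
      rw [← Finset.sum_div, norm_div, div_pow, vnorm_ψ, Complex.norm_real, Real.norm_eq_abs,
        sq_abs, mul_div_assoc]
  · rw [Finset.sum_filter]
    refine Finset.sum_congr rfl fun j _ ↦ ?_
    rw [pilotWeight]
    split_ifs
    · rw [mul_pow, Real.sq_sqrt (S.ρi_nonneg j), Real.sq_sqrt hτ.le]; ring
    · ring

lemma cov_ulCoeff_ulCoeff (k : K) (t : Fin τ) (m m' : Fin M) :
    S.cov k (S.ulCoeff t m) (S.ulCoeff t m') = if m = m' then ((S.α t + S.σ2 : ℝ) : ℂ) else 0 := by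
  rw [cov, Source.sum_eq]
  by_cases h : m = m'
  · subst h
    simp only [ulCoeff, ite_mul, zero_mul, mul_zero, apply_ite conj, map_zero, mul_ite,
      Finset.sum_ite_eq, Finset.mem_univ, if_true, Finset.sum_const_zero, add_zero, sourceVar,
      Finset.sum_ite_irrel]
    rw [← Finset.mul_sum, sum_norm_sq_div_sqrt S.ψ_orth, alpha_eq]
    simp only [Complex.mul_conj, Complex.normSq_eq_norm_sq, Complex.norm_real, Real.norm_eq_abs,
      sq_abs]
    push_cast
    ring
  · rw [if_neg h]
    have (m'' : Fin M) (a b : ℂ) :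
        (if m = m'' then a else 0) * (starRingEnd ℂ) (if m' = m'' then b else 0) = 0 := by
      by_cases h1 : m = m''
      · rw [if_neg (c := m' = m'') (fun h2 ↦ h (h1.trans h2.symm))]; simp
      · simp [h1]
    simp [ulCoeff, this]

end Cell

/-- Needed for `y_t ≠ 0` almost surely, so that the precoder `y_t^* / ‖y_t‖` has unit norm. -/
lemma nullSingletonClass_complexGaussian {v : ℝ} (hv : 0 < v) :
    NullSingletonClass (complexGaussian v) := by
  have := nullSingletonClass_gaussianReal (μ := 0) (v := (v / 2).toNNReal)
    (Real.toNNReal_pos.2 (by positivity)).ne'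
  refine ⟨fun z ↦ ?_⟩
  rw [complexGaussian, Measure.map_apply measurable_complex_mk (measurableSet_singleton z)]
  have h : (fun p : ℝ × ℝ ↦ (⟨p.1, p.2⟩ : ℂ)) ⁻¹' {z} ⊆ {(z.re, z.im)} := by
    rintro ⟨a, b⟩ rfl
    rfl
  exact measure_mono_null h (measure_singleton _)

namespace Cell

variable {K L J : Type*} {τ M : ℕ} (S : Cell K L J τ)

/-! ### The law of `Re z_k` -/

lemma sourceVar_nonneg (k : K) (s : Source K L J τ M) : 0 ≤ S.sourceVar k s := by
  cases s
  · exact (S.β_pos _).le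
  · exact S.βd_nonneg _
  · exact S.βi_nonneg _
  · exact S.σ2_pos.le
  · exact S.Υ_nonneg _
  · exact S.σ2_pos.le

lemma omega_nonneg [Fintype L] [Fintype J] (t : Fin τ) : 0 ≤ S.ω t := by
  refine add_nonneg (Finset.sum_nonneg fun l _ ↦ ?_) (Finset.sum_nonneg fun j _ ↦ ?_)
  · exact mul_nonneg (S.βd_nonneg l) (by positivity)
  · exact mul_nonneg (mul_nonneg (S.ρi_nonneg j) (Nat.cast_nonneg _)) (S.βi_nonneg j)

lemma ueWeight_nonneg (t : Fin τ) (k : K) : 0 ≤ S.ueWeight t k := by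
  rw [ueWeight]; split_ifs <;> positivity

/-- The weights of the residual of `h_k` and of the downlink noise in `z_k`, given `y_t`. -/
noncomputable def residualWeight (y : Fin M → ℂ) : Fin M ⊕ Unit → ℂ :=
  Sum.elim (fun m ↦ (√S.q * √(τ : ℝ) / vnorm y : ℝ) * conj (y m)) (fun _ ↦ 1)

lemma measurable_residualWeight : Measurable (S.residualWeight (M := M)) := by
  refine measurable_pi_iff.2 fun j ↦ ?_
  rcases j with m | _
  · simp only [residualWeight, Sum.elim_inl]
    fun_prop
  · simp only [residualWeight, Sum.elim_inr]
    fun_prop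

variable [Fintype K]

lemma pilot_eq {t : Fin τ} {k : K} (hk : k ∈ S.contenders t) : S.c k = t ∧ 0 < S.ρ k := by
  simpa [contenders] using hk

lemma signal_pos {t : Fin τ} {k : K} (hk : k ∈ S.contenders t) : 0 < S.ρ k * S.β k * τ :=
  mul_pos (mul_pos (S.pilot_eq hk).2 (S.β_pos k)) (tau_pos t)

lemma ueWeight_sq {t : Fin τ} {k : K} (hk : k ∈ S.contenders t) :
    S.ueWeight t k ^ 2 = S.ρ k * τ := by
  rw [ueWeight, if_pos (S.pilot_eq hk).1, mul_pow, Real.sq_sqrt (S.ρ_nonneg k),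
    Real.sq_sqrt (tau_pos t).le]

variable [Fintype L] [Fintype J]

lemma le_alpha {t : Fin τ} {k : K} (hk : k ∈ S.contenders t) : S.ρ k * S.β k * τ ≤ S.α t := by
  have h := Finset.single_le_sum (f := fun i ↦ S.ρ i * S.β i * τ)
    (fun i _ ↦ mul_nonneg (mul_nonneg (S.ρ_nonneg i) (S.β_pos i).le) (Nat.cast_nonneg _)) hk
  have := S.omega_nonneg t
  rw [α]
  linarith

lemma alpha_add_pos {t : Fin τ} {k : K} (hk : k ∈ S.contenders t) : 0 < S.α t + S.σ2 := by
  have := S.le_alpha hk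
  have := S.signal_pos hk
  have := S.σ2_pos
  linarith

lemma lam1_pos {t : Fin τ} {k : K} (hk : k ∈ S.contenders t) : 0 < S.lam1 t k := by
  have h1 := tau_pos t
  have h2 := S.β_pos k
  have h3 := S.q_pos
  have h4 := (S.pilot_eq hk).2
  exact div_pos (by positivity) (S.alpha_add_pos hk)

/-- The gain of UE `k` is one summand of `α_t`, hence less than `α_t + σ²`. The difference of the
two sides is the residual channel's share of `λ₂`. -/
lemma lam1_lt {t : Fin τ} {k : K} (hk : k ∈ S.contenders t) :
    S.lam1 t k < S.q * S.β k * τ := by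
  have h1 := tau_pos t
  have h2 := S.β_pos k
  have h3 := S.q_pos
  rw [lam1, div_lt_iff₀ (S.alpha_add_pos hk)]
  have : S.ρ k * S.q * S.β k ^ 2 * (τ : ℝ) ^ 2 = S.q * S.β k * τ * (S.ρ k * S.β k * τ) := by ring
  rw [this]
  have := S.le_alpha hk
  have := S.σ2_pos
  gcongr
  linarith

lemma lam2_pos {t : Fin τ} {k : K} (hk : k ∈ S.contenders t) : 0 < S.lam2 t k := by
  have := S.lam1_lt hk
  have := S.σ2_pos
  have := S.Υ_nonneg k
  rw [lam2]
  linarith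

/-- The coefficient of the linear regression of `[h_k]_m` on `[y_t]_m`. -/
noncomputable def regCoeff (t : Fin τ) (k : K) : ℝ := S.β k * S.ueWeight t k / (S.α t + S.σ2)

/-- The variance of the part of `[h_k]_m` that is not explained by `[y_t]_m`. -/
noncomputable def residualVar (t : Fin τ) (k : K) : ℝ :=
  S.β k - S.regCoeff t k * (S.β k * S.ueWeight t k)

lemma mul_residualVar {t : Fin τ} {k : K} (hk : k ∈ S.contenders t) :
    S.q * τ * S.residualVar t k = S.q * S.β k * τ - S.lam1 t k := by
  have h := (S.alpha_add_pos hk).ne'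
  have : S.regCoeff t k * (S.β k * S.ueWeight t k)
      = S.ρ k * τ * S.β k ^ 2 / (S.α t + S.σ2) := by
    rw [regCoeff, ← S.ueWeight_sq hk]; ring
  rw [residualVar, this, lam1]
  ring

lemma residualVar_nonneg {t : Fin τ} {k : K} (hk : k ∈ S.contenders t) :
    0 ≤ S.residualVar t k := by
  have h1 := S.mul_residualVar hk
  have h2 := S.lam1_lt hk
  have h3 : 0 < S.q * τ := mul_pos S.q_pos (tau_pos t)
  nlinarith

/-- The coefficients of `y_t`, of the residual of `h_k`, and of the downlink noise. -/
noncomputable def jointCoeff (t : Fin τ) (k : K) :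
    Fin M ⊕ (Fin M ⊕ Unit) → Source K L J τ M → ℂ
  | .inl m => S.ulCoeff t m
  | .inr (.inl m) => fun s ↦ chCoeff k m s - S.regCoeff t k * S.ulCoeff t m s
  | .inr (.inr _) => S.dlCoeff t

/-- The variances of the residual of `h_k` and of the downlink noise. -/
noncomputable def residualVars (t : Fin τ) (k : K) : Fin M ⊕ Unit → ℝ :=
  Sum.elim (fun _ ↦ S.residualVar t k) (fun _ ↦ S.Υ k + S.σ2)

/-- The variances of `y_t`, of the residual of `h_k`, and of the downlink noise. -/
noncomputable def jointVars (t : Fin τ) (k : K) : Fin M ⊕ (Fin M ⊕ Unit) → ℝ :=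
  Sum.elim (fun _ ↦ S.α t + S.σ2) (S.residualVars t k)

lemma residualVars_nonneg {t : Fin τ} {k : K} (hk : k ∈ S.contenders t) (j : Fin M ⊕ Unit) :
    0 ≤ S.residualVars t k j := by
  rcases j with m | _
  · exact S.residualVar_nonneg hk
  · exact add_nonneg (S.Υ_nonneg k) S.σ2_pos.le

lemma jointVars_nonneg {t : Fin τ} {k : K} (hk : k ∈ S.contenders t)
    (j : Fin M ⊕ (Fin M ⊕ Unit)) : 0 ≤ S.jointVars t k j := by
  rcases j with m | j
  · exact (S.alpha_add_pos hk).le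
  · exact S.residualVars_nonneg hk j

/-- The regression coefficient is chosen to make the residual uncorrelated with `y_t`, and the
downlink noise uses separate sources. By `map_linear_complexGaussian` this lack of correlation is
independence. -/
lemma cov_jointCoeff {t : Fin τ} {k : K} (hk : k ∈ S.contenders t)
    (j j' : Fin M ⊕ (Fin M ⊕ Unit)) :
    S.cov k (S.jointCoeff t k j) (S.jointCoeff t k j')
      = if j = j' then (S.jointVars t k j : ℂ) else 0 := by
  have hN : ((S.α t + S.σ2 : ℝ) : ℂ) ≠ 0 := by exact_mod_cast (S.alpha_add_pos hk).ne'
  have hreg : (S.regCoeff t k : ℂ) * ((S.α t + S.σ2 : ℝ) : ℂ) = S.β k * S.ueWeight t k := by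
    rw [regCoeff]; push_cast at hN ⊢; field_simp
  have hul (m m' : Fin M) : S.cov k (S.ulCoeff t m) (chCoeff k m')
      = if m = m' then (S.β k * S.ueWeight t k : ℂ) else 0 := by
    rw [cov_conj, cov_chCoeff_ulCoeff]
    by_cases h : m = m'
    · simp [h]
    · simp [h, Ne.symm h]
  have hres (m m' : Fin M) : S.cov k (S.ulCoeff t m)
      (fun s ↦ chCoeff k m' s - S.regCoeff t k * S.ulCoeff t m' s) = 0 := by
    rw [cov_sub_smul_right, hul, cov_ulCoeff_ulCoeff]
    split_ifs
    · rw [hreg, sub_self]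
    · simp
  have hdl (m : Fin M) : S.cov k (fun s ↦ chCoeff k m s - S.regCoeff t k * S.ulCoeff t m s)
      (S.dlCoeff t) = 0 := by
    rw [cov_sub_smul_left, cov_chCoeff_dlCoeff, cov_ulCoeff_dlCoeff]; simp
  rcases j with m | m | _ <;> rcases j' with m' | m' | _
  · simp [jointCoeff, jointVars, cov_ulCoeff_ulCoeff]
  · simp [jointCoeff, hres]
  · simp [jointCoeff, cov_ulCoeff_dlCoeff]
  · rw [cov_conj]
    simp [jointCoeff, hres]
  · simp only [jointCoeff]
    rw [cov_sub_smul_left, hres, cov_conj, cov_sub_smul_left, cov_chCoeff_chCoeff, hul]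
    by_cases h : m = m'
    · simp [h, jointVars, residualVars, residualVar]
    · simp [h, Ne.symm h]
  · simp [jointCoeff, hdl]
  · rw [cov_conj]
    simp [jointCoeff, cov_ulCoeff_dlCoeff]
  · rw [cov_conj]
    simp [jointCoeff, hdl]
  · simp [jointCoeff, jointVars, residualVars, cov_dlCoeff_dlCoeff]

/-- The residual is weighted by `√(q τ)` times a unit vector, so its conditional variance does not
depend on `y`. -/
lemma sum_residualWeight {t : Fin τ} {k : K} (hk : k ∈ S.contenders t) {y : Fin M → ℂ}
    (hy : y ≠ 0) :
    ∑ j, S.residualVars t k j * ‖S.residualWeight y j‖ ^ 2 = S.lam2 t k := by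
  have hy' : vnorm y ^ 2 ≠ 0 := by
    refine pow_ne_zero 2 (norm_ne_zero_iff.2 fun h ↦ hy ?_)
    simpa using congrArg WithLp.ofLp h
  simp only [Fintype.sum_sum_type, residualVars, residualWeight, Sum.elim_inl, Sum.elim_inr,
    norm_mul, mul_pow, Complex.norm_real, Real.norm_eq_abs, sq_abs, RCLike.norm_conj]
  rw [← Finset.mul_sum, ← Finset.mul_sum, ← vnorm_sq, div_pow, div_mul_cancel₀ _ hy', mul_pow,
    Real.sq_sqrt S.q_pos.le, Real.sq_sqrt (tau_pos t).le, mul_comm, S.mul_residualVar hk]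
  simp [lam2]
  ring

lemma z_eq_sum (t : Fin τ) (k : K) (x : Source K L J τ M → ℂ) :
    S.z x t k = (√S.q * √(τ : ℝ) / vnorm (S.y x t) : ℝ) *
        (∑ m, x (.channel k m) * conj (S.y x t m))
      + ∑ s, S.dlCoeff t s * x s := by
  have hV (m : Fin M) : ∑ s, S.V x m s * (conj (S.φ t s) / (√(τ : ℝ) : ℂ))
      = (√S.q * √(τ : ℝ) / vnorm (S.y x t) : ℝ) * conj (S.y x t m) := by
    simp only [V, mul_assoc, Finset.sum_mul]
    rw [← Finset.mul_sum, Finset.sum_comm]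
    simp_rw [← Finset.mul_sum, sum_mul_conj_div_sqrt S.φ_orth]
    simp
    ring
  rw [Source.sum_eq]
  simp only [z, zvec, vnorm_φ, dlCoeff, zero_mul, Finset.sum_const_zero, zero_add, add_mul,
    Finset.sum_add_distrib, Finset.sum_mul]
  rw [Finset.sum_comm]
  simp_rw [mul_assoc, ← Finset.mul_sum, hV, Finset.mul_sum, mul_comm (x (.dlInterference _)),
    mul_comm (x (.dlNoise _)), ← add_assoc]
  congr 3 with m
  ring

/-- `Re z_k` as a function of the independent Gaussian variables `y_t`, the residual of `h_k`,
and the downlink noise. -/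
lemma re_z_eq (t : Fin τ) (k : K) (x : Source K L J τ M → ℂ) :
    (S.z x t k).re = √S.q * √(τ : ℝ) * S.regCoeff t k * vnorm (S.y x t)
      + (∑ j, S.residualWeight (S.y x t) j * ∑ s, S.jointCoeff t k (.inr j) s * x s).re := by
  have he (m : Fin M) : ∑ s, S.jointCoeff t k (.inr (.inl m)) s * x s
      = x (.channel k m) - S.regCoeff t k * S.y x t m := by
    simp only [jointCoeff, sub_mul, Finset.sum_sub_distrib, chCoeff_sum, mul_assoc,
      ← Finset.mul_sum, y_eq_sum]
  have hyy : ∑ m, S.y x t m * conj (S.y x t m) = ((vnorm (S.y x t) ^ 2 : ℝ) : ℂ) := by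
    simp_rw [vnorm_sq, Complex.mul_conj, Complex.normSq_eq_norm_sq]
    push_cast; rfl
  -- Also valid for `y_t = 0`, where division by zero gives `0`.
  have hv : vnorm (S.y x t) ^ 2 / vnorm (S.y x t) = vnorm (S.y x t) := by
    rw [sq, mul_self_div_self]
  have hsum : ∑ j, S.residualWeight (S.y x t) j * ∑ s, S.jointCoeff t k (.inr j) s * x s
      = S.z x t k - (√S.q * √(τ : ℝ) * S.regCoeff t k * vnorm (S.y x t) : ℝ) := by
    simp only [Fintype.sum_sum_type, he]
    rw [z_eq_sum]
    simp only [residualWeight, Sum.elim_inl, Sum.elim_inr, jointCoeff, Finset.univ_unique,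
      Finset.sum_singleton, one_mul]
    have : ∑ m, ((√S.q * √(τ : ℝ) / vnorm (S.y x t) : ℝ) : ℂ) * conj (S.y x t m)
          * (x (.channel k m) - S.regCoeff t k * S.y x t m)
        = (√S.q * √(τ : ℝ) / vnorm (S.y x t) : ℝ) * (∑ m, x (.channel k m) * conj (S.y x t m))
          - ((√S.q * √(τ : ℝ) / vnorm (S.y x t) : ℝ) * S.regCoeff t k)
            * ∑ m, S.y x t m * conj (S.y x t m) := by
      rw [Finset.mul_sum, Finset.mul_sum, ← Finset.sum_sub_distrib]
      exact Finset.sum_congr rfl fun m _ ↦ by ring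
    rw [this, hyy]
    have h2 : ((√S.q * √(τ : ℝ) / vnorm (S.y x t) : ℝ) * S.regCoeff t k : ℂ)
        * ((vnorm (S.y x t) ^ 2 : ℝ) : ℂ)
        = (√S.q * √(τ : ℝ) * S.regCoeff t k * vnorm (S.y x t) : ℝ) := by
      rw [← Complex.ofReal_mul, ← Complex.ofReal_mul]
      congr 1
      conv_rhs => rw [← hv]
      ring
    rw [h2]
    ring
  rw [hsum, Complex.sub_re, Complex.ofReal_re]
  ring

lemma measurable_re_z (t : Fin τ) (k : K) :
    Measurable (fun x : Source K L J τ M → ℂ ↦ (S.z x t k).re) := by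
  have hy : Measurable (fun x : Source K L J τ M → ℂ ↦ S.y x t) :=
    measurable_pi_iff.2 fun m ↦ by simp_rw [y_eq_sum]; fun_prop
  have hw (j : Fin M ⊕ Unit) : Measurable (fun x ↦ S.residualWeight (S.y x t) j) :=
    (measurable_pi_iff.1 S.measurable_residualWeight j).comp hy
  simp_rw [re_z_eq]
  fun_prop

/-- The law of the sources is pushed to the product law of `y_t`, the residual and the downlink
noise; the last two then contribute a Gaussian factor of variance `λ₂ / 2`. -/
lemma charFun_re_z {t : Fin τ} {k : K} (hk : k ∈ S.contenders t) (hM : 0 < M)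
    {Ω : Type*} [MeasurableSpace Ω] {P : Measure Ω} [IsProbabilityMeasure P]
    {X : Source K L J τ M → Ω → ℂ} (hX : S.IsRayleigh k P X) (r : ℝ) :
    charFun (P.map (fun ω ↦ (S.z (fun s ↦ X s ω) t k).re)) r
      = charFun ((Measure.pi (fun _ : Fin M ↦ complexGaussian (S.α t + S.σ2))).map
          (fun y ↦ √S.q * √(τ : ℝ) * S.regCoeff t k * vnorm y)) r
        * Complex.exp (-(S.lam2 t k * r ^ 2 / 4 : ℝ)) := by
  have hXm (s : Source K L J τ M) : AEMeasurable (X s) P := (hX.hasLaw s).aemeasurable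
  have hpi : P.map (fun ω s ↦ X s ω) = Measure.pi fun s ↦ complexGaussian (S.sourceVar k s) := by
    rw [(iIndepFun_iff_map_fun_eq_pi_map hXm).1 hX.indep]
    congr 1 with s : 1
    exact (hX.hasLaw s).map_eq
  have hlin := map_linear_complexGaussian (S.sourceVar_nonneg k) (S.jointVars_nonneg hk)
    (S.jointCoeff (M := M) t k) (S.cov_jointCoeff hk)
  have hsplit := (measurePreserving_sumPiEquivProdPi
    (fun j : Fin M ⊕ (Fin M ⊕ Unit) ↦ complexGaussian (S.jointVars t k j))).map_eq
  have hw := S.measurable_residualWeight (M := M)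
  have hw' (j : Fin M ⊕ Unit) : Measurable (fun y ↦ S.residualWeight (M := M) y j) := hw.eval
  have hg : Measurable (fun p : (Fin M → ℂ) × (Fin M ⊕ Unit → ℂ) ↦
      √S.q * √(τ : ℝ) * S.regCoeff t k * vnorm p.1
        + (∑ j, S.residualWeight p.1 j * p.2 j).re) := by
    fun_prop
  have hA : Measurable (fun (x : Source K L J τ M → ℂ) j ↦ ∑ i, S.jointCoeff t k j i * x i) := by
    fun_prop
  have hmap : P.map (fun ω ↦ (S.z (fun s ↦ X s ω) t k).re)
      = ((Measure.pi (fun _ : Fin M ↦ complexGaussian (S.α t + S.σ2))).prod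
          (Measure.pi (fun j : Fin M ⊕ Unit ↦ complexGaussian (S.residualVars t k j)))).map
        (fun p ↦ √S.q * √(τ : ℝ) * S.regCoeff t k * vnorm p.1
          + (∑ j, S.residualWeight p.1 j * p.2 j).re) := by
    have h1 : P.map (fun ω ↦ (S.z (fun s ↦ X s ω) t k).re)
        = (P.map (fun ω s ↦ X s ω)).map (fun x ↦ (S.z x t k).re) :=
      (AEMeasurable.map_map_of_aemeasurable (S.measurable_re_z t k).aemeasurable
        (aemeasurable_pi_lambda _ hXm)).symm
    rw [h1, hpi]
    change _ = ((Measure.pi (fun i : Fin M ↦ complexGaussian (S.jointVars t k (.inl i)))).prod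
          (Measure.pi (fun j : Fin M ⊕ Unit ↦
            complexGaussian (S.jointVars t k (.inr j))))).map _
    rw [← hsplit, ← hlin, Measure.map_map hg (MeasurableEquiv.measurable _),
      Measure.map_map (hg.comp (MeasurableEquiv.measurable _)) hA]
    congr 1 with x
    rw [re_z_eq]
    have hy : S.y x t = fun m ↦ ∑ s, S.jointCoeff t k (.inl m) s * x s := by
      ext m; exact S.y_eq_sum t m x
    rw [hy]
    rfl
  rw [hmap]
  refine charFun_map_add_re_sum (S.residualVars_nonneg hk)
    (f := fun y ↦ √S.q * √(τ : ℝ) * S.regCoeff t k * vnorm y) (by fun_prop) hw ?_ r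
  have := nullSingletonClass_complexGaussian (S.alpha_add_pos hk)
  -- At least one antenna is needed: for `M = 0` the only vector is zero.
  have h0 : ∀ᵐ y : Fin M → ℂ ∂Measure.pi (fun _ ↦ complexGaussian (S.α t + S.σ2)), y ≠ 0 := by
    rw [ae_iff]
    simp only [ne_eq, not_not, Set.ofPred_eq_eq_singleton]
    rw [Measure.pi_singleton]
    exact Finset.prod_eq_zero (Finset.mem_univ ⟨0, hM⟩) (measure_singleton _)
  filter_upwards [h0] with y hy
  exact S.sum_residualWeight hk hy

end Cell

lemma tendsto_Q_const_sub_gammaRatio {a s₀ : ℝ} {s : ℕ → ℝ} (ha : 0 < a) (hs₀ : 0 < s₀)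
    (hs : Tendsto s atTop (𝓝 s₀)) (b : ℝ) :
    Tendsto (fun M ↦ Q ((b - gammaRatio M * a) / s M)) atTop (𝓝 1) := by
  have h1 : Tendsto (fun M ↦ b - gammaRatio M * a) atTop atBot := by
    simp_rw [sub_eq_add_neg]
    exact tendsto_atBot_add_const_left _ _
      (tendsto_neg_atTop_atBot.comp (tendsto_gammaRatio_atTop.atTop_mul_const ha))
  exact tendsto_Q_atBot.comp (h1.atBot_mul_pos (inv_pos.2 hs₀) (hs.inv₀ hs₀.ne'))

namespace Cell

variable {K L J : Type*} {τ : ℕ} (S : Cell K L J τ)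
variable [Fintype K] [Fintype L] [Fintype J]

/-! ### Asymptotics -/

lemma amplitude_eq {t : Fin τ} {k : K} (hk : k ∈ S.contenders t) :
    √S.q * √(τ : ℝ) * S.regCoeff t k = √(S.lam1 t k) / √(S.α t + S.σ2) := by
  have hN := S.alpha_add_pos hk
  have hreg : 0 ≤ S.regCoeff t k :=
    div_nonneg (mul_nonneg (S.β_pos k).le (S.ueWeight_nonneg t k)) hN.le
  have hl : 0 ≤ √S.q * √(τ : ℝ) * S.regCoeff t k := by positivity
  rw [← Real.sqrt_div (S.lam1_pos hk).le, ← Real.sqrt_sq hl]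
  congr 1
  rw [mul_pow, mul_pow, Real.sq_sqrt S.q_pos.le, Real.sq_sqrt (tau_pos t).le, regCoeff, div_pow,
    mul_pow, S.ueWeight_sq hk, lam1]
  field_simp

/-- Three factors: the norm fluctuation gives variance `λ₁ / 4`, the conditional Gaussian part gives
`λ₂ / 2`, and the deterministic shift `√λ₁ (√M - C_M)` vanishes. -/
lemma tendsto_charFun_centered {t : Fin τ} {k : K} (hk : k ∈ S.contenders t)
    {Ω : ℕ → Type*} [∀ M, MeasurableSpace (Ω M)] {P : ∀ M, Measure (Ω M)}
    [∀ M, IsProbabilityMeasure (P M)] {X : ∀ M, Source K L J τ M → Ω M → ℂ}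
    (hX : ∀ M, S.IsRayleigh k (P M) (X M)) (r : ℝ) :
    Tendsto (fun M ↦ charFun (((P M).map (fun ω ↦ (S.z (fun s ↦ X M s ω) t k).re)).map
        (· - gammaRatio M * √(S.lam1 t k))) r) atTop
      (𝓝 (Complex.exp (-((S.lam1 t k / 4 + S.lam2 t k / 2) * r ^ 2 / 2 : ℝ)))) := by
  have hl := S.lam1_pos hk
  have hN := S.alpha_add_pos hk
  have h1 := tendsto_charFun_vnorm hN (r * √(S.lam1 t k))
  have h2 : Tendsto (fun M : ℕ ↦ Complex.exp
      ((r * √(S.lam1 t k) * (√(M : ℝ) - gammaRatio M) : ℝ) * Complex.I)) atTop (𝓝 1) := by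
    have h := tendsto_sqrt_sub_gammaRatio.const_mul (r * √(S.lam1 t k))
    have hc : Continuous fun a : ℝ ↦ Complex.exp (a * Complex.I) := by fun_prop
    simpa [Function.comp_def] using (hc.tendsto _).comp h
  have h3 := (h1.mul_const (Complex.exp (-(S.lam2 t k * r ^ 2 / 4 : ℝ)))).mul h2
  have hlim : Complex.exp (-((r * √(S.lam1 t k)) ^ 2 / 8 : ℝ))
        * Complex.exp (-(S.lam2 t k * r ^ 2 / 4 : ℝ)) * 1
      = Complex.exp (-((S.lam1 t k / 4 + S.lam2 t k / 2) * r ^ 2 / 2 : ℝ)) := by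
    rw [mul_one, ← Complex.exp_add, mul_pow, Real.sq_sqrt hl.le]
    congr 1
    push_cast
    ring
  rw [hlim] at h3
  refine h3.congr' ?_
  filter_upwards [eventually_gt_atTop 0] with M hM
  simp_rw [sub_eq_add_neg]
  rw [charFun_map_add_const, S.charFun_re_z hk hM (hX M), charFun_apply_real,
    integral_map (by fun_prop) (by fun_prop), S.amplitude_eq hk]
  simp_rw [← integral_mul_const]
  refine integral_congr_ae (ae_of_all _ fun y ↦ ?_)
  simp only [← Complex.exp_add]
  congr 1
  simp only [Real.inner_apply]
  push_cast
  ring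

lemma aemeasurable_re_z {M : ℕ} {t : Fin τ} {k : K} {Ω : Type*} [MeasurableSpace Ω]
    {P : Measure Ω} [IsProbabilityMeasure P] {X : Source K L J τ M → Ω → ℂ}
    (hX : S.IsRayleigh k P X) :
    AEMeasurable (fun ω ↦ (S.z (fun s ↦ X s ω) t k).re) P :=
  (S.measurable_re_z t k).comp_aemeasurable
    (aemeasurable_pi_lambda _ fun s ↦ (hX.hasLaw s).aemeasurable)

lemma tendsto_scale (t : Fin τ) (k : K) :
    Tendsto (fun M : ℕ ↦ √(S.lam1 t k * ((M : ℝ) - gammaRatio M ^ 2) + S.lam2 t k / 2))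
      atTop (𝓝 √(S.lam1 t k / 4 + S.lam2 t k / 2)) := by
  have := (tendsto_sub_gammaRatio_sq.const_mul (S.lam1 t k)).add_const (S.lam2 t k / 2)
  rw [mul_one_div] at this
  exact this.sqrt

/-- The normal approximation of `Re z_k`, uniformly in the argument of the tail function. -/
lemma tendstoUniformly_tail_re_z {t : Fin τ} {k : K} (hk : k ∈ S.contenders t)
    {Ω : ℕ → Type*} [∀ M, MeasurableSpace (Ω M)] {P : ∀ M, Measure (Ω M)}
    [∀ M, IsProbabilityMeasure (P M)] {X : ∀ M, Source K L J τ M → Ω M → ℂ}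
    (hX : ∀ M, S.IsRayleigh k (P M) (X M)) :
    TendstoUniformly
      (fun (M : ℕ) (b : ℝ) =>
        (P M).real {w | b < (S.z (fun s => X M s w) t k).re}
          - Q ((b - gammaRatio M * √(S.lam1 t k))
              / √(S.lam1 t k * ((M : ℝ) - gammaRatio M ^ 2) + S.lam2 t k / 2)))
      (fun _ => 0) atTop := by
  have hl1 := S.lam1_pos hk
  have hl2 := S.lam2_pos hk
  have hm (M : ℕ) := S.aemeasurable_re_z (t := t) (hX M)
  have hp (M : ℕ) := Measure.isProbabilityMeasure_map (hm M)
  have h := tendstoUniformly_tail_sub_Q (v := S.lam1 t k / 4 + S.lam2 t k / 2) (by positivity)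
    (fun _ ↦ Real.sqrt_nonneg _) (S.tendsto_scale t k) (S.tendsto_charFun_centered hk hX)
  simp_rw [map_measureReal_apply_of_aemeasurable (hm _) measurableSet_Ioi] at h
  exact h

section Tail

variable {t : Fin τ} {k : K} {Ω : ℕ → Type*} [∀ M, MeasurableSpace (Ω M)] {P : ∀ M, Measure (Ω M)}
  [∀ M, IsProbabilityMeasure (P M)] {X : ∀ M, Source K L J τ M → Ω M → ℂ}

lemma tendsto_tail_re_z_sub (hk : k ∈ S.contenders t) (hX : ∀ M, S.IsRayleigh k (P M) (X M))
    (b : ℕ → ℝ) :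
    Tendsto (fun M : ℕ ↦ (P M).real {w | b M < (S.z (fun s => X M s w) t k).re}
          - Q ((b M - gammaRatio M * √(S.lam1 t k))
              / √(S.lam1 t k * ((M : ℝ) - gammaRatio M ^ 2) + S.lam2 t k / 2)))
      atTop (𝓝 0) := by
  have h := S.tendstoUniformly_tail_re_z hk hX
  rw [Metric.tendstoUniformly_iff] at h
  rw [Metric.tendsto_nhds]
  intro ε hε
  filter_upwards [h ε hε] with M hM
  rw [dist_comm]
  exact hM (b M)

/-- For thresholds proportional to `C_M`, the tail probability of `Re z_k` tends to `0`, `1 / 2`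
or `1`. -/
lemma tendsto_tail_re_z (hk : k ∈ S.contenders t) (hX : ∀ M, S.IsRayleigh k (P M) (X M)) (κ : ℝ) :
    Tendsto (fun M : ℕ ↦
        (P M).real {w | κ * gammaRatio M < (S.z (fun s => X M s w) t k).re}) atTop
      (𝓝 (if √(S.lam1 t k) < κ then 0 else if κ = √(S.lam1 t k) then 1 / 2 else 1)) := by
  have hl1 := S.lam1_pos hk
  have hl2 := S.lam2_pos hk
  have hs : 0 < √(S.lam1 t k / 4 + S.lam2 t k / 2) := Real.sqrt_pos.2 (by positivity)
  have hdiv := (tendsto_const_nhds (x := κ - √(S.lam1 t k))).div (S.tendsto_scale t k) hs.ne'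
  have hQ : Tendsto (fun M : ℕ ↦ Q ((κ * gammaRatio M - gammaRatio M * √(S.lam1 t k))
        / √(S.lam1 t k * ((M : ℝ) - gammaRatio M ^ 2) + S.lam2 t k / 2))) atTop
      (𝓝 (if √(S.lam1 t k) < κ then 0 else if κ = √(S.lam1 t k) then 1 / 2 else 1)) := by
    -- Since `C_M → ∞` and the scale has a positive limit, the sign of `κ - √λ₁` decides; in the
    -- equality case the argument is identically `0`.
    have he (M : ℕ) : (κ * gammaRatio M - gammaRatio M * √(S.lam1 t k))
        / √(S.lam1 t k * ((M : ℝ) - gammaRatio M ^ 2) + S.lam2 t k / 2)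
        = gammaRatio M * ((κ - √(S.lam1 t k))
        / √(S.lam1 t k * ((M : ℝ) - gammaRatio M ^ 2) + S.lam2 t k / 2)) := by ring
    simp_rw [he]
    split_ifs with h1 h2
    · exact tendsto_Q_atTop.comp
        (tendsto_gammaRatio_atTop.atTop_mul_pos (div_pos (sub_pos.2 h1) hs) hdiv)
    · simp [h2, Q_zero]
    · have h3 : κ - √(S.lam1 t k) < 0 := sub_neg.2 (lt_of_le_of_ne (not_lt.1 h1) h2)
      exact tendsto_Q_atBot.comp
        (tendsto_gammaRatio_atTop.atTop_mul_neg (div_neg_of_neg_of_pos h3 hs) hdiv)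
  simpa using (S.tendsto_tail_re_z_sub hk hX (fun M ↦ κ * gammaRatio M)).add hQ

lemma tendsto_tail_re_z_const (hk : k ∈ S.contenders t) (hX : ∀ M, S.IsRayleigh k (P M) (X M))
    (b : ℝ) :
    Tendsto (fun M : ℕ ↦ (P M).real {w | b < (S.z (fun s => X M s w) t k).re}) atTop (𝓝 1) := by
  have hl1 := S.lam1_pos hk
  have hl2 := S.lam2_pos hk
  have hQ := tendsto_Q_const_sub_gammaRatio (Real.sqrt_pos.2 hl1)
    (Real.sqrt_pos.2 (show 0 < S.lam1 t k / 4 + S.lam2 t k / 2 by positivity))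
    (S.tendsto_scale t k) b
  simpa using (S.tendsto_tail_re_z_sub hk hX (fun _ ↦ b)).add hQ

/-! ### The decision rule -/

/-- The bound on `ε` makes the second argument of the maximum satisfy the inequality automatically.
-/
lemma repeats_iff {M : ℕ} {ε : ℝ} (hε : ε < S.ρ k * S.β k * τ / 2)
    (x : Source K L J τ M → ℂ) :
    S.Repeats x t k ε ↔
      gammaRatio M ^ 2 * (S.q * S.ρ k * S.β k ^ 2 * (τ : ℝ) ^ 2 / (S.z x t k).re ^ 2)
        < 2 * (S.ρ k * S.β k * τ - ε) + S.σ2 := by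
  have : S.Repeats x t k ε ↔ S.αhat x t k < 2 * (S.ρ k * S.β k * τ - ε) := by
    rw [Repeats]; constructor <;> intro h <;> linarith
  rw [this, αhat, max_lt_iff, sub_lt_iff_lt_add]
  exact and_iff_left (by linarith)

/-- The threshold, as a multiple of `C_M`, that `Re z_k` has to exceed for a repetition. -/
noncomputable def repeatThreshold (k : K) (ε : ℝ) : ℝ :=
  √(S.q * S.ρ k * S.β k ^ 2 * (τ : ℝ) ^ 2 / (2 * (S.ρ k * S.β k * τ - ε) + S.σ2))

lemma repeats_iff_of_pos {M : ℕ} (hk : k ∈ S.contenders t) {ε : ℝ}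
    (hε : ε < S.ρ k * S.β k * τ / 2) (hM : 0 < M) {x : Source K L J τ M → ℂ}
    (hz : 0 < (S.z x t k).re) :
    S.Repeats x t k ε ↔ S.repeatThreshold k ε * gammaRatio M < (S.z x t k).re := by
  have hA := S.signal_pos hk
  have hσ := S.σ2_pos
  have hT : 0 < 2 * (S.ρ k * S.β k * τ - ε) + S.σ2 := by linarith
  have hB : 0 ≤ S.q * S.ρ k * S.β k ^ 2 * (τ : ℝ) ^ 2 := by
    have := S.q_pos
    have := (S.pilot_eq hk).2
    positivity
  have hC := gammaRatio_pos hM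
  have h0 : 0 ≤ S.repeatThreshold k ε * gammaRatio M := mul_nonneg (Real.sqrt_nonneg _) hC.le
  rw [S.repeats_iff hε, ← sq_lt_sq₀ h0 hz.le, mul_pow, repeatThreshold,
    Real.sq_sqrt (div_nonneg hB hT.le), ← mul_div_assoc, div_lt_iff₀ (by positivity),
    div_mul_eq_mul_div, div_lt_iff₀ hT, mul_comm (gammaRatio M ^ 2),
    mul_comm (2 * (S.ρ k * S.β k * τ - ε) + S.σ2)]

/-- The rule sees only `(Re z_k)²`, so it may also fire for `Re z_k ≤ 0`. The probability is
squeezed between the tail at the threshold and that tail plus the vanishing probability of `Re z_k ≤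
0`. -/
lemma tendsto_repeats (hk : k ∈ S.contenders t) (hX : ∀ M, S.IsRayleigh k (P M) (X M)) {ε : ℝ}
    (hε : ε < S.ρ k * S.β k * τ / 2) :
    Tendsto (fun M : ℕ => (P M).real {w | S.Repeats (fun s => X M s w) t k ε}) atTop
      (𝓝 (if √(S.lam1 t k) < S.repeatThreshold k ε then 0
        else if S.repeatThreshold k ε = √(S.lam1 t k) then 1 / 2 else 1)) := by
  have hlow := S.tendsto_tail_re_z hk hX (S.repeatThreshold k ε)
  have hneg : Tendsto (fun M : ℕ ↦
      1 - (P M).real {w | 0 < (S.z (fun s => X M s w) t k).re}) atTop (𝓝 0) := by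
    simpa using (S.tendsto_tail_re_z_const hk hX 0).const_sub 1
  have hup := hlow.add hneg
  rw [add_zero] at hup
  refine tendsto_of_tendsto_of_tendsto_of_le_of_le' hlow hup ?_ ?_
  · filter_upwards [eventually_gt_atTop 0] with M hM
    refine measureReal_mono fun w hw ↦ ?_
    have hw' : S.repeatThreshold k ε * gammaRatio M < (S.z (fun s => X M s w) t k).re := hw
    have hz := (mul_nonneg (Real.sqrt_nonneg _) (gammaRatio_pos hM).le).trans_lt hw'
    exact (S.repeats_iff_of_pos hk hε hM hz).2 hw'
  · filter_upwards [eventually_gt_atTop 0] with M hM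
    have hnull : NullMeasurableSet {w | 0 < (S.z (fun s => X M s w) t k).re} (P M) :=
      (S.aemeasurable_re_z (hX M)).nullMeasurable measurableSet_Ioi
    rw [← probReal_compl_eq_one_sub₀ hnull]
    refine (measureReal_mono fun w hw ↦ ?_).trans (measureReal_union_le _ _)
    by_cases hz : 0 < (S.z (fun s => X M s w) t k).re
    · exact Or.inl ((S.repeats_iff_of_pos hk hε hM hz).1 hw)
    · exact Or.inr hz

lemma sqrt_lam1_eq (t : Fin τ) (k : K) :
    √(S.lam1 t k) = √(S.q * S.ρ k * S.β k ^ 2 * (τ : ℝ) ^ 2 / (S.α t + S.σ2)) := by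
  rw [lam1, mul_comm (S.ρ k)]

/-- Both radicands have the same numerator, so only `α_t + σ²` and `2 (ρ_k β_k τ - ε) + σ²` are
compared. -/
lemma sqrt_lam1_lt_repeatThreshold_iff (hk : k ∈ S.contenders t) {ε : ℝ}
    (hε : ε < S.ρ k * S.β k * τ / 2) :
    √(S.lam1 t k) < S.repeatThreshold k ε ↔ S.ρ k * S.β k * τ < S.α t / 2 + ε := by
  have hA := S.signal_pos hk
  have hσ := S.σ2_pos
  have hT : 0 < 2 * (S.ρ k * S.β k * τ - ε) + S.σ2 := by linarith
  have hN := S.alpha_add_pos hk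
  have hB : 0 < S.q * S.ρ k * S.β k ^ 2 * (τ : ℝ) ^ 2 := by
    have := S.q_pos
    have := (S.pilot_eq hk).2
    have := S.β_pos k
    have := tau_pos t
    positivity
  rw [sqrt_lam1_eq, repeatThreshold, Real.sqrt_lt_sqrt_iff (div_pos hB hN).le,
    div_lt_div_iff_of_pos_left hB hN hT]
  constructor <;> intro h <;> linarith

lemma repeatThreshold_eq_sqrt_lam1_iff (hk : k ∈ S.contenders t) {ε : ℝ}
    (hε : ε < S.ρ k * S.β k * τ / 2) :
    S.repeatThreshold k ε = √(S.lam1 t k) ↔ S.ρ k * S.β k * τ = S.α t / 2 + ε := by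
  have hA := S.signal_pos hk
  have hσ := S.σ2_pos
  have hT : 0 < 2 * (S.ρ k * S.β k * τ - ε) + S.σ2 := by linarith
  have hN := S.alpha_add_pos hk
  have hB : 0 < S.q * S.ρ k * S.β k ^ 2 * (τ : ℝ) ^ 2 := by
    have := S.q_pos
    have := (S.pilot_eq hk).2
    have := S.β_pos k
    have := tau_pos t
    positivity
  rw [sqrt_lam1_eq, repeatThreshold, Real.sqrt_inj (div_pos hB hT).le (div_pos hB hN).le,
    div_eq_div_iff hT.ne' hN.ne', mul_right_inj' hB.ne']
  constructor <;> intro h <;> linarith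

end Tail

end Cell

end SUCRe

theorem corollary1 {K L J : Type*} [Fintype K] [Fintype L] [Fintype J] {τ : ℕ}
    (S : SUCRe.Cell K L J τ) (t : Fin τ) (k : K) (hk : k ∈ S.contenders t)
    {Ω : ℕ → Type*} [∀ M, MeasurableSpace (Ω M)] (P : ∀ M, Measure (Ω M))
    [∀ M, IsProbabilityMeasure (P M)]
    (X : ∀ M, SUCRe.Source K L J τ M → Ω M → ℂ) (hX : ∀ M, S.IsRayleigh k (P M) (X M)) :
    -- normal approximation, uniformly in the argument of the complementary CDF
    TendstoUniformly
      (fun (M : ℕ) (b : ℝ) =>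
        (P M).real {w | b < (S.z (fun s => X M s w) t k).re}
          - SUCRe.Q ((b - SUCRe.gammaRatio M * Real.sqrt (S.lam1 t k))
              / Real.sqrt (S.lam1 t k * ((M : ℝ) - SUCRe.gammaRatio M ^ 2) + S.lam2 t k / 2)))
      (fun _ => 0) atTop ∧
    -- for each fixed argument, also with `λ₁² (M - C_M²) + λ₂` as the variance
    (∀ b : ℝ, Tendsto
      (fun M : ℕ =>
        (P M).real {w | b < (S.z (fun s => X M s w) t k).re}
          - SUCRe.Q ((b - SUCRe.gammaRatio M * Real.sqrt (S.lam1 t k))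
              / Real.sqrt (S.lam1 t k ^ 2 * ((M : ℝ) - SUCRe.gammaRatio M ^ 2)
                  + S.σ2 + S.Υ k + S.q * S.β k * τ - S.lam1 t k)))
      atTop (𝓝 0)) ∧
    -- the limit of the probability of repeating the pilot
    (∀ ε : ℝ, ε < S.ρ k * S.β k * τ / 2 →
      Tendsto (fun M : ℕ => (P M).real {w | S.Repeats (fun s => X M s w) t k ε}) atTop
        (𝓝 (if S.ρ k * S.β k * τ < S.α t / 2 + ε then 0
            else if S.ρ k * S.β k * τ = S.α t / 2 + ε then 1 / 2
            else 1))) := by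
  have hl1 := S.lam1_pos hk
  refine ⟨S.tendstoUniformly_tail_re_z hk hX, fun b ↦ ?_, fun ε hε ↦ ?_⟩
  · have hl2 := S.lam2_pos hk
    have hv := ((SUCRe.tendsto_sub_gammaRatio_sq.const_mul (S.lam1 t k ^ 2)).add_const
      (S.lam2 t k)).sqrt
    have hQ := SUCRe.tendsto_Q_const_sub_gammaRatio (Real.sqrt_pos.2 hl1)
      (Real.sqrt_pos.2 (by positivity)) hv b
    -- Both terms tend to `1` separately; of the modified variance only the positivity of its limit
    -- `λ₁² / 4 + λ₂` matters.
    have h := (S.tendsto_tail_re_z_const hk hX b).sub hQ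
    rw [sub_self] at h
    simpa only [SUCRe.Cell.lam2, ← add_assoc, ← add_sub_assoc] using h
  · simpa only [S.sqrt_lam1_lt_repeatThreshold_iff hk hε,
      S.repeatThreshold_eq_sqrt_lam1_iff hk hε] using S.tendsto_repeats hk hX hε
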